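/- **Setting.** Let $X=[0,1]^d$, let $Y\subset\mathbb R^d$ be compact, and let $\mu$, $\nu$ be probability measures on $X$, $Y$ with $\mu\ll\mathcal L$ (Lebesgue measure). $\Pi(\alpha,\beta)$ denotes the nonnegative measures with marginals $\alpha,\beta$. For every even $n\ge 2$ let $I^n=\{0,\dots,n-1\}^d$, let $X_i^n=i/n+[0,1/n]^d$ for $i\in I^n$, and assume $m_i^n=\mu(X_i^n)>0$. The composite partition $\mathcal J_A^n$ of $I^n$ groups the indices along each axis as $\{0,1\},\{2,3\},\dots,\{n-2,n-1\}$, and $\mathcal J_B^n$ groups them as $\{0\},\{1,2\},\dots,\{n-3,n-2\},\{n-1\}$. For a composite cell $J$ put $X_J^n=\bigcup_{i\in J}X_i^n$ and $m_J^n=\sum_{i\in J} m_i^n$, and let $x_J^n$ be the unique point of $\{\frac1n,\frac3n,\dots,\frac{n-1}n\}^d$ (if $J\in\mathcal J^n_A$), respectively of $\{0,\frac2n,\dots,1\}^d$ (if $J\in\mathcal J^n_B$), that lies in $X_J^n$. For $k\ge 0$ let $\mathcal J^{n,k}$ be $\mathcal J^n_A$ if $k$ is odd and $\mathcal J^n_B$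 if $k$ is even. For even $n\ge2$ let $\mu^n$, $\nu^n$ be probability measures on $X$, $Y$ such that $\mu^n(X_i^n)=m_i^n$ for all $i\in I^n$, $\mu^n(X^n_i\cap X^n_j)=0$ for $i\ne j$, and $\nu^n\rightharpoonup\nu$ weak*; let $\pi^n_{\rm init}\in\Pi(\mu^n,\nu^n)$ converge weak* to $\pi_{\rm init}\in\Pi(\mu,\nu)$. Let $c\in C^1(X\times Y)$ and $c^n=c+f^n/n$ with (measurable) functions $f^n\to0$ uniformly on $X\times Y$, and let $\varepsilon^n\in[0,\infty)$ be such that $n\varepsilon^n$ converges to some $\eta\in[0,\infty]$. For every even $n\ge2$ let $(\pi^{n,k})_{k\ge0}$ be iterates of the domain decomposition algorithm: $\pi^{n,0}=\pi^n_{\rm init}$, and $\pi^{n,k+1}=\sum_{J\in\mathcal J^{n,k+1}}\pi_J$, where each $\pi_J$ minimizes $\int c^n\,d\pi+\varepsilon^n\,\mathrm{KL}(\pi\,|\,\mu^n_J\otimes\nu^n)$ over $\pi\in\Pi(\mu^n_J,\nu^{n,k}_J)$, with $\mu^n_J=\mu^n|_{X^n_J}$ and $\nu^{n,k}_J$ the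 $Y$-marginal of $\pi^{n,k}|_{X^n_J\times Y}$. Let $\nu^{n,k}_i$ be the $Y$-marginal of $\pi^{n,k}|_{X_i^n\times Y}$. The discrete trajectory $\boldsymbol\pi^n$ and momentum $\boldsymbol\omega^n$ are the measures on $\mathbb R_+\times X\times Y$ (scalar and nonnegative, respectively $\mathbb R^d$-valued) whose disintegrations with respect to $\mathcal L\otimes\mu$ are, for $k=\lfloor nt\rfloor$ and $x\in X_J^n$, $J\in\mathcal J^{n,k}$, $$\boldsymbol\pi^n_{t,x}=\frac{1}{m_J^n}\,\nu_J^{n,k},\qquad \boldsymbol\omega^n_{t,x}=\frac1{m_J^n}\sum_{i\in J}\nu^{n,k}_{i}\cdot n\,(x^n_{\hat J(i)}-x^n_J),$$ where $\hat J(i)$ is the composite cell of the other partition that contains $i$; and $\boldsymbol\pi^n_t$ is the measure on $X\times Y$ with first marginal $\mu$ and disintegration $(\boldsymbol\pi^n_{t,x})_x$. For $\pi,\pi'$ with first marginal $\mu$ let $\mathcal W(\pi,\pi')=\int_X W_Y(\pi_x,\pi'_x)\,d\mu(x)$, where $W_Y$ is the Wasserstein-1 distance and $\pi_x$, $\pi_x'$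 are the disintegrations with respect to $\mu$. **Proposition.** Let $\boldsymbol\pi=\mathcal L\otimes\boldsymbol\pi_t$ be a nonnegative measure on $\mathbb R_+\times X\times Y$ with $\boldsymbol\pi_t\in\Pi(\mu,\nu)$ for a.e. $t\ge0$, and let $\mathcal Z\subset2\mathbb N$ be an infinite set with $\lim_{n\in\mathcal Z,\,n\to\infty}\mathcal W(\boldsymbol\pi^n_t,\boldsymbol\pi_t)=0$ for a.e. $t\ge0$. Let $\boldsymbol\omega$ be an $\mathbb R^d$-valued measure on $\mathbb R_+\times X\times Y$ that is finite on compact time intervals, and let $\hat{\mathcal Z}\subset\mathcal Z$ be an infinite subset along which $\boldsymbol\omega^n|_{[0,T]\times X\times Y}$ converges weak* to $\boldsymbol\omega|_{[0,T]\times X\times Y}$ for every $T\in(0,\infty)$. Then $(\boldsymbol\pi,\boldsymbol\omega)$ solves the horizontal continuity equation $\partial_t\boldsymbol\pi_t+\operatorname{div}_X\boldsymbol\omega_t=0$, $\boldsymbol\pi_{t=0}=\pi_{\rm init}$ in the distributional sense: for all $\phi\in C^1_c(\mathbb R_+\times X\times Y)$, $$\int_{\mathbb R_+\times X\times Y}\partial_t\phi\,d\boldsymbol\pi+\int_{\mathbb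 R_+\times X\times Y}\nabla_X\phi\cdot d\boldsymbol\omega=-\int_{X\times Y}\phi(0,x,y)\,d\pi_{\rm init}(x,y).$$ -/

import Mathlib

open MeasureTheory ProbabilityTheory Filter Set
open scoped Topology NNReal ENNReal

noncomputable section

namespace DomDec

/-- Euclidean space `ℝ^d`; both `X = [0,1]^d` and `Y` are subsets of it. -/
abbrev E (d : ℕ) : Type := EuclideanSpace ℝ (Fin d)

/-- `X = [0,1]^d`. -/
def unitCube (d : ℕ) : Set (E d) := {x | ∀ l, x l ∈ Icc (0 : ℝ) 1}

/-! ### Transport plans, the Wasserstein distance, the vertical transport metric -/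

/-- `π ∈ Π(μ,ν)`: the marginals of `π` are `μ` and `ν`. -/
def IsCoupling {α β : Type*} [MeasurableSpace α] [MeasurableSpace β]
    (π : Measure (α × β)) (μ : Measure α) (ν : Measure β) : Prop :=
  π.fst = μ ∧ π.snd = ν

/-- The Wasserstein-1 distance. -/
def wasserstein1 {d : ℕ} (ρ ρ' : Measure (E d)) : ℝ≥0∞ :=
  ⨅ (γ : Measure (E d × E d)) (_ : IsCoupling γ ρ ρ'), ∫⁻ p, edist p.1 p.2 ∂γ

/-- The vertical transport metric `𝒲(π,π') = ∫_X W_Y(π_x, π'_x) dμ(x)` for `π`, `π'` with first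
marginal `μ`; `π_x` is the disintegration of `π` with respect to its first marginal. -/
def verticalDist {d : ℕ} (μ : Measure (E d)) (π π' : Measure (E d × E d))
    [IsFiniteMeasure π] [IsFiniteMeasure π'] : ℝ≥0∞ :=
  ∫⁻ x, wasserstein1 (π.condKernel x) (π'.condKernel x) ∂μ

/-! ### Basic and composite cells -/

/-- The admissible discretization levels `n ∈ 2ℕ` (with `n > 0`). -/
def levels : Set ℕ := {n | Even n ∧ 0 < n}

/-- `n → ∞` along a set `Z` of levels. -/
def along (Z : Set ℕ) : Filter ℕ := atTop ⊓ 𝓟 Z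

/-- The index set `{0,…,n-1}^d` of the basic cells. -/
def basicIndices (d n : ℕ) : Finset (Fin d → ℕ) := Fintype.piFinset fun _ => Finset.range n

/-- The basic cell `X_i = i/n + [0,1/n]^d`. -/
def basicCell {d : ℕ} (n : ℕ) (i : Fin d → ℕ) : Set (E d) :=
  {x | ∀ l, x l ∈ Icc ((i l : ℝ) / n) (((i l : ℝ) + 1) / n)}

/-- The two kinds of composite partitions. -/
inductive Kind : Type
  | A
  | B

/-- The partition which is not `τ`. -/
def Kind.other : Kind → Kind
  | .A => .B
  | .B => .A

/-- Along each axis, partition `A` groups the basic indices as `{0,1}, {2,3}, …` and partition `B`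
groups them as `{0}, {1,2}, {3,4}, …, {n-1}`; this is the number of the group of `i`. -/
def Kind.label : Kind → ℕ → ℕ
  | .A, i => i / 2
  | .B, i => (i + 1) / 2

/-- The partition used in iteration `k`: `A` for odd `k`, `B` for even `k`. -/
def kindAt (k : ℕ) : Kind := if Odd k then .A else .B

/-- The composite cell of kind `τ` containing the basic cell `i`, as a set of basic indices. -/
def compositeCell {d : ℕ} (n : ℕ) (τ : Kind) (i : Fin d → ℕ) : Finset (Fin d → ℕ) :=
  (basicIndices d n).filter fun j => ∀ l, τ.label (j l) = τ.label (i l)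

/-- The composite partition of kind `τ` of the set of basic indices. -/
def compositePartition (d n : ℕ) (τ : Kind) : Finset (Finset (Fin d → ℕ)) :=
  (basicIndices d n).image (compositeCell n τ)

/-- `X_J`, the union of the basic cells `X_i`, `i ∈ J`. -/
def cellSet {d : ℕ} (n : ℕ) (J : Finset (Fin d → ℕ)) : Set (E d) := ⋃ i ∈ J, basicCell n i

/-- The center `x_J` of the composite cell `J` of kind `τ` that contains the basic cell `i`: the
point of the grid `{1/n, 3/n, …, (n-1)/n}^d` (kind `A`) or `{0, 2/n, …, 1}^d` (kind `B`) that lies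
in `X_J`. -/
def cellCenter {d : ℕ} (n : ℕ) (τ : Kind) (i : Fin d → ℕ) : E d :=
  WithLp.toLp 2 fun l =>
    match τ with
    | .A => (2 * (Kind.label .A (i l) : ℝ) + 1) / n
    | .B => (2 * (Kind.label .B (i l) : ℝ)) / n

/-- `P_Y (π ⌞ (S × Y))`. -/
def partialMarginal {d : ℕ} (π : Measure (E d × E d)) (S : Set (E d)) : Measure (E d) :=
  (π.restrict (S ×ˢ univ)).snd

/-! ### The domain decomposition algorithm -/

open Classical in
/-- The objective `∫ c dπ + ε KL(π | ref)` of a cell problem. -/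
def cellObjective {d : ℕ} (c : E d × E d → ℝ) (ε : ℝ≥0) (ref π : Measure (E d × E d)) : EReal :=
  if Integrable c π then
    ((∫ p, c p ∂π : ℝ) : EReal) + (((ε : ℝ≥0∞) * InformationTheory.klDiv π ref : ℝ≥0∞) : EReal)
  else ⊤

/-- `π` solves the (entropic) optimal transport problem between the marginals `μJ`, `νJ` with cost
`c`, regularization `ε` and reference measure `μJ ⊗ ν`. -/
def IsCellSolution {d : ℕ} (c : E d × E d → ℝ) (ε : ℝ≥0) (μJ ν νJ : Measure (E d))
    (π : Measure (E d × E d)) : Prop :=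
  IsCoupling π μJ νJ ∧ ∀ π' : Measure (E d × E d), IsCoupling π' μJ νJ →
    cellObjective c ε (μJ.prod ν) π ≤ cellObjective c ε (μJ.prod ν) π'

/-- `π` is a sequence of iterates of the domain decomposition algorithm at level `n` for the
marginals `μ`, `ν`, started in `π₀`: in iteration `k + 1` the current plan is replaced, in each
composite cell `J`, by a solution of the cell problem whose marginals are `μ ⌞ X_J` and the
`Y`-marginal of the current plan on `X_J × Y`. -/
structure IsDomDecRun {d : ℕ} (n : ℕ) (c : E d × E d → ℝ) (ε : ℝ≥0) (μ ν : Measure (E d))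
    (π₀ : Measure (E d × E d)) (π : ℕ → Measure (E d × E d)) : Prop where
  zero : π 0 = π₀
  step : ∀ k, ∃ sol : Finset (Fin d → ℕ) → Measure (E d × E d),
    (∀ J ∈ compositePartition d n (kindAt (k + 1)),
      IsCellSolution c ε (μ.restrict (cellSet n J)) ν
        (partialMarginal (π k) (cellSet n J)) (sol J)) ∧
    π (k + 1) = ∑ J ∈ compositePartition d n (kindAt (k + 1)), sol J

/-- The setting: an optimal transport problem on `X × Y` with `X = [0,1]^d`, its approximations at
the levels `n ∈ 2ℕ`, and iterates of the domain decomposition algorithm at all these levels. (The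
values of the sequences at other `n` are irrelevant.) -/
structure Setting (d : ℕ) where
  Y : Set (E d)
  isCompact_Y : IsCompact Y
  /-- the marginals -/
  μ : ProbabilityMeasure (E d)
  ν : ProbabilityMeasure (E d)
  μ_supp : (μ : Measure (E d)) (unitCube d)ᶜ = 0
  ν_supp : (ν : Measure (E d)) Yᶜ = 0
  μ_ac : (μ : Measure (E d)) ≪ volume
  /-- the basic cells are a basic partition: each of them carries mass -/
  μ_pos : ∀ n ∈ levels, ∀ i ∈ basicIndices d n, 0 < (μ : Measure (E d)) (basicCell n i)
  /-- the approximate marginals -/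
  μn : ℕ → ProbabilityMeasure (E d)
  νn : ℕ → ProbabilityMeasure (E d)
  μn_supp : ∀ n ∈ levels, (μn n : Measure (E d)) (unitCube d)ᶜ = 0
  νn_supp : ∀ n ∈ levels, (νn n : Measure (E d)) Yᶜ = 0
  μn_cell : ∀ n ∈ levels, ∀ i ∈ basicIndices d n,
    (μn n : Measure (E d)) (basicCell n i) = (μ : Measure (E d)) (basicCell n i)
  /-- no mass on the common boundary of two basic cells -/
  μn_overlap : ∀ n ∈ levels, ∀ i ∈ basicIndices d n, ∀ j ∈ basicIndices d n, i ≠ j →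
    (μn n : Measure (E d)) (basicCell n i ∩ basicCell n j) = 0
  νn_tendsto : Tendsto νn (along levels) (𝓝 ν)
  /-- the initial plans -/
  πinit : ProbabilityMeasure (E d × E d)
  πinit_coupling : IsCoupling (πinit : Measure (E d × E d)) μ ν
  πinitn : ℕ → ProbabilityMeasure (E d × E d)
  πinitn_coupling : ∀ n ∈ levels, IsCoupling (πinitn n : Measure (E d × E d)) (μn n) (νn n)
  πinitn_tendsto : Tendsto πinitn (along levels) (𝓝 πinit)
  /-- the cost `c` and the approximate costs `c + f n / n` -/
  c : E d × E d → ℝ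
  c_contDiff : ContDiffOn ℝ 1 c (unitCube d ×ˢ Y)
  f : ℕ → E d × E d → ℝ
  f_measurable : ∀ n, Measurable (f n)
  f_tendsto : TendstoUniformlyOn f (fun _ => 0) (along levels) (unitCube d ×ˢ Y)
  /-- the regularization parameters -/
  ε : ℕ → ℝ≥0
  η : ℝ≥0∞
  ε_tendsto : Tendsto (fun n : ℕ => (n : ℝ≥0∞) * (ε n : ℝ≥0∞)) (along levels) (𝓝 η)
  /-- the iterates `π^{n,k}` -/
  iter : ℕ → ℕ → ProbabilityMeasure (E d × E d)
  iter_run : ∀ n ∈ levels, IsDomDecRun n (fun p => c p + f n p / n) (ε n) (μn n) (νn n)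
    (πinitn n) (fun k => (iter n k : Measure (E d × E d)))

namespace Setting

variable {d : ℕ} (S : Setting d)

/-- The partial `Y`-marginal `ν_J^{n,k}`; `ν_i^{n,k}` is the case `J = {i}`. -/
def cellMarginal (n k : ℕ) (J : Finset (Fin d → ℕ)) : Measure (E d) :=
  partialMarginal (S.iter n k : Measure (E d × E d)) (cellSet n J)

instance (n k : ℕ) (J : Finset (Fin d → ℕ)) : IsFiniteMeasure (S.cellMarginal n k J) := by
  unfold cellMarginal partialMarginal
  infer_instance

/-- The mass `m_J = μ(X_J)`. -/
def mass (n : ℕ) (J : Finset (Fin d → ℕ)) : ℝ≥0 :=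
  ((S.μ : Measure (E d)) (cellSet n J)).toNNReal

/-- The discrete trajectory at time `t`: with `k = ⌊n t⌋`, the measure on `X × Y` whose
disintegration with respect to `μ` is `ν_J^{n,k} / m_J` at the points of `X_J`, for every composite
cell `J` of the partition of iteration `k`. -/
def discTrajectory (n : ℕ) (t : ℝ) : Measure (E d × E d) :=
  ∑ J ∈ compositePartition d n (kindAt ⌊(n : ℝ) * t⌋₊),
    ((S.μ : Measure (E d)).restrict (cellSet n J)).prod
      ((S.mass n J)⁻¹ • S.cellMarginal n ⌊(n : ℝ) * t⌋₊ J)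

instance (n : ℕ) (t : ℝ) : IsFiniteMeasure (S.discTrajectory n t) := by
  unfold discTrajectory
  infer_instance

/-- For a composite cell `J` of iteration `k` and `i ∈ J`, the `l`-th component of
`n (x_J' - x_J)`, where `J'` is the neighboring composite cell (of the other partition) with
`J ∩ J' = {i}`. -/
def direction (n k : ℕ) (i : Fin d → ℕ) (l : Fin d) : ℝ :=
  n * (cellCenter n (kindAt k).other i l - cellCenter n (kindAt k) i l)

/-- The measure on `X × Y` whose disintegration with respect to `μ` is
`(1/m_J) ∑_{i ∈ J} w(i) ν_i^{n,k}` at the points of `X_J`. -/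
def weightedCells (n k : ℕ) (w : (Fin d → ℕ) → ℝ≥0) : Measure (E d × E d) :=
  ∑ J ∈ compositePartition d n (kindAt k),
    ((S.μ : Measure (E d)).restrict (cellSet n J)).prod
      ((S.mass n J)⁻¹ • ∑ i ∈ J, w i • S.cellMarginal n k {i})

end Setting

/-- A signed measure on `ℝ × ℝ^d × ℝ^d`, not necessarily finite, written as a difference of two
nonnegative measures. -/
structure SignedPair (d : ℕ) where
  pos : Measure (ℝ × E d × E d)
  neg : Measure (ℝ × E d × E d)

namespace SignedPair

variable {d : ℕ}

/-- The signed measure lives on `[0,∞) × X × Y` and is finite on compact time intervals. -/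
structure IsRadonOn (Y : Set (E d)) (m : SignedPair d) : Prop where
  pos_supp : m.pos (Ici (0 : ℝ) ×ˢ unitCube d ×ˢ Y)ᶜ = 0
  neg_supp : m.neg (Ici (0 : ℝ) ×ˢ unitCube d ×ˢ Y)ᶜ = 0
  pos_lt_top : ∀ T : ℝ, m.pos (Icc 0 T ×ˢ univ) < ∞
  neg_lt_top : ∀ T : ℝ, m.neg (Icc 0 T ×ˢ univ) < ∞

/-- The integral against the signed measure. -/
def integral (m : SignedPair d) (f : ℝ × E d × E d → ℝ) : ℝ :=
  (∫ p, f p ∂m.pos) - ∫ p, f p ∂m.neg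

/-- The restriction to the time interval `[0,T]`. -/
def upTo (m : SignedPair d) (T : ℝ) : SignedPair d where
  pos := m.pos.restrict (Icc 0 T ×ˢ univ)
  neg := m.neg.restrict (Icc 0 T ×ˢ univ)

end SignedPair

namespace Setting

variable {d : ℕ} (S : Setting d)

/-- The `l`-th component of the discrete momentum `ω^n`: for `t ∈ [k/n, (k+1)/n)` and `x ∈ X_J`
its disintegration with respect to Lebesgue measure and `μ` is
`(1/m_J) ∑_{i ∈ J} n (x_J' - x_J)_l ν_i^{n,k}` (see `direction`). -/
def discMomentum (n : ℕ) (l : Fin d) : SignedPair d where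
  pos := Measure.sum fun k : ℕ =>
    (volume.restrict (Ico ((k : ℝ) / n) (((k : ℝ) + 1) / n))).prod
      (S.weightedCells n k fun i => (direction n k i l).toNNReal)
  neg := Measure.sum fun k : ℕ =>
    (volume.restrict (Ico ((k : ℝ) / n) (((k : ℝ) + 1) / n))).prod
      (S.weightedCells n k fun i => (-direction n k i l).toNNReal)

/-- The discrete trajectories converge to `(π_t)` in the vertical transport metric, for almost every
`t ≥ 0`, along the subsequence `Z`. -/
structure TrajectoryConverges (Z : Set ℕ) (π : Kernel ℝ (E d × E d)) [IsFiniteKernel π] :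
    Prop where
  subset : Z ⊆ levels
  infinite : Z.Infinite
  coupling : ∀ᵐ t ∂(volume.restrict (Ici (0 : ℝ))), IsCoupling (π t) S.μ S.ν
  tendsto : ∀ᵐ t ∂(volume.restrict (Ici (0 : ℝ))),
    Tendsto (fun n => verticalDist (S.μ : Measure (E d)) (S.discTrajectory n t) (π t))
      (along Z) (𝓝 0)

/-- The discrete momenta, restricted to `[0,T]`, converge weak* to `ω` restricted to `[0,T]`, for
every `T > 0`, along the subsequence `Z`. -/
def MomentumConverges (Z : Set ℕ) (ω : Fin d → SignedPair d) : Prop :=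
  ∀ T : ℝ, 0 < T → ∀ l : Fin d, ∀ f : ℝ × E d × E d → ℝ, Continuous f →
    Tendsto (fun n => ((S.discMomentum n l).upTo T).integral f) (along Z)
      (𝓝 (((ω l).upTo T).integral f))

end Setting

/-! ### Test functions and the horizontal continuity equation -/

/-- `φ ∈ C¹_c([0,∞) × X × Y)`. -/
structure IsTestFunction {d : ℕ} (Y : Set (E d)) (φ : ℝ × E d × E d → ℝ) : Prop where
  contDiffOn : ContDiffOn ℝ 1 φ (Ici (0 : ℝ) ×ˢ unitCube d ×ˢ Y)
  compact_supp : ∃ K : Set (ℝ × E d × E d), IsCompact K ∧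
    ∀ p ∈ Ici (0 : ℝ) ×ˢ unitCube d ×ˢ Y, p ∉ K → φ p = 0

/-- The derivative of `φ` in `(t,x) ∈ [0,∞) × X` at fixed `y` (one-sided at the boundary). -/
def derivTX {d : ℕ} (φ : ℝ × E d × E d → ℝ) (p : ℝ × E d × E d) : ℝ × E d →L[ℝ] ℝ :=
  fderivWithin ℝ (fun z : ℝ × E d => φ (z.1, z.2, p.2.2)) (Ici (0 : ℝ) ×ˢ unitCube d) (p.1, p.2.1)

/-- `∂_t φ`. -/
def timeDeriv {d : ℕ} (φ : ℝ × E d × E d → ℝ) (p : ℝ × E d × E d) : ℝ :=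
  derivTX φ p (1, 0)

/-- The `l`-th component of `∇_X φ`. -/
def spaceDeriv {d : ℕ} (φ : ℝ × E d × E d → ℝ) (l : Fin d) (p : ℝ × E d × E d) : ℝ :=
  derivTX φ p (0, EuclideanSpace.single l 1)

/-- `(π, ω)` solves `∂_t π + div_X ω = 0`, `π_{t=0} = π₀` on `[0,∞) × X × Y` in the sense of
distributions. -/
def SolvesHorizontalCE {d : ℕ} (Y : Set (E d)) (π : Measure (ℝ × E d × E d))
    (ω : Fin d → SignedPair d) (π₀ : Measure (E d × E d)) : Prop :=
  ∀ φ : ℝ × E d × E d → ℝ, IsTestFunction Y φ →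
    (∫ p, timeDeriv φ p ∂π) + ∑ l, (ω l).integral (spaceDeriv φ l)
      = -∫ q, φ (0, q.1, q.2) ∂π₀

end DomDec

end

/-! Fix `n` and follow `A k = ∑ i, ∫ φ(k/n, x_J, y) dν_i^{n,k}(y)`, where `J` is the composite cell
of iteration `k` containing `i` (`cellSum`). Iteration `k + 1` changes the `ν_i` but keeps the
marginal of every composite cell it acts on, and the center is constant on such a cell. So `A (k +
1)` may be computed with the old marginals and the new centers (`cellMarginal_succ`,
`cellSum_succ`), and `A (k + 1) - A k` is the sum over `i` of the integrals, against the single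
measure `ν_i^{n,k}`, of the increment of `φ` from `(k/n, x_J)` to `((k+1)/n, x_{Ĵ(i)})`.

Both centers are vertices of the basic cell `i`, so this increment is taken over a distance
`O(1/n)`. By Taylor expansion, `n` times it is `∂_t φ + n (x_{Ĵ(i)} - x_J) · ∇_X φ`, up to a uniform
`o(1)`, at every `(t, x, y)` with `t` in the `k`-th time slice and `x ∈ X_J`
(`IsTestFunction.eventually_abs_sub_le`). Spreading `ν_i` over `X_J` turns the two terms into the
discrete trajectory and the discrete momentum (`abs_step_sub_le`).

Summation over `k < n T`, with `φ = 0` from time `T` on, telescopes to `-A 0`, which is close to `-∫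
φ(0, ·) dπ_init^n`. Hence the discrete pair solves the continuity equation up to `o(1)`
(`tendsto_discrete_continuity_equation`).

In the limit, convergence in the vertical metric gives weak convergence at almost every time, and
dominated convergence integrates it (`TrajectoryConverges.tendsto_integral`); the momentum and
initial terms converge weakly by assumption. -/

namespace DomDec

/-! ### Test functions -/

/-- The domain `[0,∞) × X × Y` of the test functions. -/
abbrev spaceTime {d : ℕ} (Y : Set (E d)) : Set (ℝ × E d × E d) :=
  Ici (0 : ℝ) ×ˢ unitCube d ×ˢ Y

lemma isClosed_unitCube (d : ℕ) : IsClosed (unitCube d) := by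
  simp only [unitCube, ofPred_forall]
  exact isClosed_iInter fun l => isClosed_Icc.preimage (by fun_prop : Continuous fun x : E d => x l)

lemma convex_unitCube (d : ℕ) : Convex ℝ (unitCube d) := by
  intro x hx y hy a b ha hb hab l
  simpa using convex_Icc (0 : ℝ) 1 (hx l) (hy l) ha hb hab

lemma norm_le_of_coord_le {d : ℕ} (v : E d) {r : ℝ} (hr : 0 ≤ r) (hv : ∀ l, |v l| ≤ r) :
    ‖v‖ ≤ d * r := by
  have h : ‖v‖ ^ 2 ≤ d * r ^ 2 := by
    rw [EuclideanSpace.real_norm_sq_eq]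
    calc ∑ i, v i ^ 2 ≤ ∑ _i : Fin d, r ^ 2 := Finset.sum_le_sum fun i _ => by
          rw [← sq_abs]; exact pow_le_pow_left₀ (abs_nonneg _) (hv i) 2
      _ = d * r ^ 2 := by simp
  have hd : (d : ℝ) ≤ (d : ℝ) ^ 2 := by exact_mod_cast Nat.le_self_pow two_ne_zero d
  refine le_of_sq_le_sq ?_ (by positivity)
  calc ‖v‖ ^ 2 ≤ d * r ^ 2 := h
    _ ≤ d ^ 2 * r ^ 2 := by gcongr
    _ = (d * r) ^ 2 := by ring

lemma isCompact_unitCube (d : ℕ) : IsCompact (unitCube d) := by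
  refine Metric.isCompact_of_isClosed_isBounded (isClosed_unitCube d) ?_
  refine isBounded_iff_forall_norm_le.2 ⟨d * 1, fun x hx => norm_le_of_coord_le x zero_le_one
    fun l => ?_⟩
  rw [abs_of_nonneg (hx l).1]
  exact (hx l).2

lemma uniqueDiffOn_Ici_prod_unitCube (d : ℕ) :
    UniqueDiffOn ℝ (Ici (0 : ℝ) ×ˢ unitCube d) := by
  refine (uniqueDiffOn_Ici 0).prod (uniqueDiffOn_convex (convex_unitCube d) ?_)
  have ho : IsOpen {x : E d | ∀ l, x l ∈ Ioo (0 : ℝ) 1} := by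
    simp only [ofPred_forall]
    exact isOpen_iInter_of_finite fun l =>
      isOpen_Ioo.preimage (by fun_prop : Continuous fun x : E d => x l)
  refine ⟨WithLp.toLp 2 fun _ => 1 / 2, interior_maximal ?_ ho ?_⟩
  · exact fun x hx l => Ioo_subset_Icc_self (hx l)
  · intro l
    norm_num

namespace IsTestFunction

variable {d : ℕ} {Y : Set (E d)} {φ : ℝ × E d × E d → ℝ}

/-- `Y` is an arbitrary compact set, so a derivative of `φ` within the full domain need not be
unique in the `y` directions. Any local continuous choice `f'` will do: composed with the inclusion
of the `(t,x)` directions it is a derivative at fixed `y`, and that one is unique. -/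
lemma exists_local_derivative (hφ : IsTestFunction Y φ) {p : ℝ × E d × E d}
    (hp : p ∈ spaceTime Y) :
    ∃ u ∈ 𝓝[spaceTime Y] p, u ⊆ spaceTime Y ∧ p ∈ u ∧
      ∃ f' : ℝ × E d × E d → (ℝ × E d × E d →L[ℝ] ℝ), ContinuousWithinAt f' (spaceTime Y) p ∧
        ∀ q ∈ u, HasFDerivWithinAt (fun z : ℝ × E d => φ (z.1, z.2, q.2.2))
          ((f' q).comp ((ContinuousLinearMap.fst ℝ ℝ (E d)).prod
            ((ContinuousLinearMap.snd ℝ ℝ (E d)).prod 0)))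
          (Ici (0 : ℝ) ×ˢ unitCube d) (q.1, q.2.1) := by
  have h := hφ.contDiffOn p hp
  rw [show (1 : WithTop ℕ∞) = 0 + 1 by norm_num,
    contDiffWithinAt_succ_iff_hasFDerivWithinAt' (by simp)] at h
  obtain ⟨u, hu, hus, -, f', hf', hc⟩ := h
  rw [insert_eq_of_mem hp] at hu hus
  refine ⟨u, hu, hus, mem_of_mem_nhdsWithin hp hu, f', hc.continuousWithinAt, fun q hq => ?_⟩
  have hqD := hus hq
  have hL : HasFDerivWithinAt (fun z : ℝ × E d => (z.1, z.2, q.2.2))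
      ((ContinuousLinearMap.fst ℝ ℝ (E d)).prod ((ContinuousLinearMap.snd ℝ ℝ (E d)).prod 0))
      (Ici (0 : ℝ) ×ˢ unitCube d) (q.1, q.2.1) :=
    hasFDerivWithinAt_fst.prodMk (hasFDerivWithinAt_snd.prodMk (hasFDerivWithinAt_const _ _ _))
  have hmaps : MapsTo (fun z : ℝ × E d => (z.1, z.2, q.2.2)) (Ici (0 : ℝ) ×ˢ unitCube d)
      (spaceTime Y) := fun z hz => ⟨hz.1, hz.2, hqD.2.2⟩
  exact (hf' q hq).comp (q.1, q.2.1) hL hmaps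

lemma hasFDerivWithinAt (hφ : IsTestFunction Y φ) {p : ℝ × E d × E d} (hp : p ∈ spaceTime Y) :
    HasFDerivWithinAt (fun z : ℝ × E d => φ (z.1, z.2, p.2.2)) (derivTX φ p)
      (Ici (0 : ℝ) ×ˢ unitCube d) (p.1, p.2.1) := by
  obtain ⟨u, -, -, hpu, f', -, hd⟩ := hφ.exists_local_derivative hp
  exact (hd p hpu).differentiableWithinAt.hasFDerivWithinAt

/-- Near `p` the canonical `derivTX` agrees with the restricted local derivative, because `[0,∞) ×
X` has unique derivatives. -/
lemma continuousOn_derivTX (hφ : IsTestFunction Y φ) :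
    ContinuousOn (derivTX φ) (spaceTime Y) := by
  intro p hp
  obtain ⟨u, hu, hus, hpu, f', hc, hd⟩ := hφ.exists_local_derivative hp
  have h : ∀ q ∈ u, derivTX φ q = (f' q).comp ((ContinuousLinearMap.fst ℝ ℝ (E d)).prod
      ((ContinuousLinearMap.snd ℝ ℝ (E d)).prod 0)) := fun q hq =>
    (hd q hq).fderivWithin (uniqueDiffOn_Ici_prod_unitCube d _ ⟨(hus hq).1, (hus hq).2.1⟩)
  refine ContinuousWithinAt.congr_of_eventuallyEq ?_ (eventually_of_mem hu h) (h p hpu)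
  exact hc.clm_comp continuousWithinAt_const

lemma continuousOn_timeDeriv (hφ : IsTestFunction Y φ) :
    ContinuousOn (timeDeriv φ) (spaceTime Y) :=
  hφ.continuousOn_derivTX.clm_apply continuousOn_const

lemma continuousOn_spaceDeriv (hφ : IsTestFunction Y φ) (l : Fin d) :
    ContinuousOn (spaceDeriv φ l) (spaceTime Y) :=
  hφ.continuousOn_derivTX.clm_apply continuousOn_const

/-- A natural number `T` is reached after exactly `n * T` steps of length `1 / n`. It lies strictly
beyond the support, so `φ` vanishes near every point of time at least `T` and its derivative
vanishes there too. -/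
lemma exists_time_bound (hφ : IsTestFunction Y φ) :
    ∃ T : ℕ, 0 < T ∧ ∀ p ∈ spaceTime Y, (T : ℝ) ≤ p.1 → φ p = 0 ∧ derivTX φ p = 0 := by
  obtain ⟨K, hK, hφK⟩ := hφ.compact_supp
  obtain ⟨r, hr⟩ := hK.isBounded.exists_norm_le
  obtain ⟨T, hT⟩ := exists_nat_gt (max r 0)
  refine ⟨T, by exact_mod_cast (le_max_right r 0).trans_lt hT, fun p hp hTp => ?_⟩
  have hzero : ∀ q ∈ spaceTime Y, r < q.1 → φ q = 0 := fun q hq hrq => by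
    refine hφK q hq fun hqK => ?_
    have h1 := (norm_fst_le q).trans (hr q hqK)
    exact absurd (le_abs_self q.1) (by rw [Real.norm_eq_abs] at h1; linarith)
  have hrp : r < p.1 := ((le_max_left r 0).trans_lt hT).trans_le hTp
  refine ⟨hzero p hp hrp, ?_⟩
  have hev : (fun z : ℝ × E d => φ (z.1, z.2, p.2.2))
      =ᶠ[𝓝[Ici (0 : ℝ) ×ˢ unitCube d] (p.1, p.2.1)] fun _ => 0 := by
    have : ∀ᶠ z : ℝ × E d in 𝓝 (p.1, p.2.1), r < z.1 :=
      continuous_fst.continuousAt.eventually (lt_mem_nhds hrp)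
    filter_upwards [self_mem_nhdsWithin, nhdsWithin_le_nhds this] with z hz hrz
    exact hzero _ ⟨hz.1, hz.2, hp.2.2⟩ hrz
  have h0 : HasFDerivWithinAt (fun z : ℝ × E d => φ (z.1, z.2, p.2.2)) 0
      (Ici (0 : ℝ) ×ˢ unitCube d) (p.1, p.2.1) :=
    (hasFDerivWithinAt_const (𝕜 := ℝ) (0 : ℝ) (p.1, p.2.1) _).congr_of_eventuallyEq hev (hzero p hp hrp)
  exact h0.fderivWithin (uniqueDiffOn_Ici_prod_unitCube d _ ⟨hp.1, hp.2.1⟩)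

end IsTestFunction

/-- A continuous function on `[0,∞) × X × Y` which vanishes for large times is the restriction of a
continuous function with compact support. -/
lemma exists_hasCompactSupport_extension {d : ℕ} {Y : Set (E d)} (hY : IsCompact Y)
    {g : ℝ × E d × E d → ℝ} (hg : ContinuousOn g (spaceTime Y)) {T : ℝ}
    (hT : ∀ p ∈ spaceTime Y, T ≤ p.1 → g p = 0) :
    ∃ G : ℝ × E d × E d → ℝ, Continuous G ∧ HasCompactSupport G ∧ EqOn G g (spaceTime Y) := by
  have hcl : IsClosed (spaceTime Y) := isClosed_Ici.prod ((isClosed_unitCube d).prod hY.isClosed)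
  -- Tietze extension, followed by a compactly supported cutoff equal to one on `[0,T] × X × Y`.
  obtain ⟨G₀, hG₀⟩ := ContinuousMap.exists_restrict_eq hcl
    ⟨(spaceTime Y).domRestrict g, continuousOn_iff_continuous_domRestrict.1 hg⟩
  have hK : IsCompact (Icc 0 T ×ˢ unitCube d ×ˢ Y) :=
    isCompact_Icc.prod ((isCompact_unitCube d).prod hY)
  obtain ⟨χ, hχ1, -, hχc, -⟩ := exists_continuous_one_zero_of_isCompact hK isClosed_empty
    (disjoint_empty _)
  refine ⟨fun p => χ p * G₀ p, χ.continuous.mul G₀.continuous, hχc.mul_right, fun p hp => ?_⟩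
  have h0 : G₀ p = g p := congrArg (fun F => F ⟨p, hp⟩) hG₀
  by_cases hpT : p.1 ≤ T
  · have : χ p = 1 := hχ1 ⟨⟨hp.1, hpT⟩, hp.2⟩
    simp [this, h0]
  · simp [h0, hT p hp (not_le.1 hpT).le]

/-- A compactly supported continuous function is Lipschitz up to an arbitrarily small error. -/
lemma exists_dist_le_add_mul_dist {α : Type*} [PseudoMetricSpace α] {G : α → ℝ}
    (hG : Continuous G) (hc : HasCompactSupport G) {δ : ℝ} (hδ : 0 < δ) :
    ∃ C : ℝ, 0 < C ∧ ∀ p q, |G p - G q| ≤ δ + C * dist p q := by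
  obtain ⟨M, hM⟩ := hc.exists_bound_of_continuous hG
  obtain ⟨r, hr, hrG⟩ := Metric.uniformContinuous_iff.1 (hc.uniformContinuous_of_continuous hG) δ hδ
  -- At distance at least `r` the oscillation `2 * |M|` is absorbed by `C * r`; the `+ 1` keeps `C`
  -- positive.
  refine ⟨(2 * |M| + 1) / r, by positivity, fun p q => ?_⟩
  by_cases hpq : dist p q < r
  · have := hrG hpq
    rw [Real.dist_eq] at this
    have : 0 ≤ (2 * |M| + 1) / r * dist p q := by positivity
    linarith
  · have h1 : |G p - G q| ≤ 2 * |M| := by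
      have h2 := abs_sub (G p) (G q)
      have h3 := hM p
      have h4 := hM q
      have h5 := le_abs_self M
      rw [Real.norm_eq_abs] at h3 h4
      linarith
    have h6 : 2 * |M| ≤ (2 * |M| + 1) / r * dist p q := by
      rw [div_mul_eq_mul_div, le_div_iff₀ hr]
      nlinarith [not_lt.1 hpq, abs_nonneg M]
    linarith

/-- First-order Taylor expansion of a test function in `(t,x)`, with a uniform error. -/
lemma IsTestFunction.exists_taylor {d : ℕ} {Y : Set (E d)} {φ : ℝ × E d × E d → ℝ}
    (hφ : IsTestFunction Y φ) (hY : IsCompact Y) (T : ℝ) {δ : ℝ} (hδ : 0 < δ) :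
    ∃ r > 0, ∀ y ∈ Y, ∀ z z₀ z₁ : ℝ × E d, (∀ w ∈ ({z, z₀, z₁} : Set (ℝ × E d)),
      w ∈ Icc 0 T ×ˢ unitCube d ∧ dist w z < r) →
      |φ (z₁.1, z₁.2, y) - φ (z₀.1, z₀.2, y) - derivTX φ (z.1, z.2, y) (z₁ - z₀)|
        ≤ δ * ‖z₁ - z₀‖ := by
  have hK : IsCompact (Icc 0 T ×ˢ unitCube d ×ˢ Y) :=
    isCompact_Icc.prod ((isCompact_unitCube d).prod hY)
  have hKD : Icc 0 T ×ˢ unitCube d ×ˢ Y ⊆ spaceTime Y :=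
    prod_mono Icc_subset_Ici_self Subset.rfl
  obtain ⟨r, hr, hrK⟩ := Metric.uniformContinuousOn_iff.1
    (hK.uniformContinuousOn_of_continuous (hφ.continuousOn_derivTX.mono hKD)) δ hδ
  refine ⟨r, hr, fun y hy z z₀ z₁ hz => ?_⟩
  set s : Set (ℝ × E d) := (Icc 0 T ×ˢ unitCube d) ∩ Metric.ball z r with hs
  have hconv : Convex ℝ s :=
    ((convex_Icc 0 T).prod (convex_unitCube d)).inter (convex_ball z r)
  have hz' := hz z (by simp)
  -- Mean value inequality for `φ` minus its linear part at `z`, on a convex set where the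
  -- derivative varies by at most `δ`. The base point `z` may differ from both endpoints.
  have := hconv.norm_image_sub_le_of_norm_hasFDerivWithin_le'
    (f := fun w : ℝ × E d => φ (w.1, w.2, y)) (f' := fun w => derivTX φ (w.1, w.2, y))
    (φ := derivTX φ (z.1, z.2, y)) (C := δ) (x := z₀) (y := z₁) ?_ ?_ (hz z₀ (by simp))
    (hz z₁ (by simp))
  · simpa using this
  · intro w hw
    exact (hφ.hasFDerivWithinAt (p := (w.1, w.2, y)) ⟨hw.1.1.1, hw.1.2, hy⟩).mono
      (inter_subset_left.trans (prod_mono Icc_subset_Ici_self Subset.rfl))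
  · intro w hw
    have := hrK (w.1, w.2, y) ⟨hw.1.1, hw.1.2, hy⟩ (z.1, z.2, y) ⟨hz'.1.1, hz'.1.2, hy⟩ (by
      have h2 : dist w z < r := hw.2
      simpa [Prod.dist_eq, hr] using h2)
    rw [dist_eq_norm] at this
    exact this.le

/-! ### Cells -/

section Cells

variable {d n : ℕ}

lemma measurableSet_basicCell (i : Fin d → ℕ) : MeasurableSet (basicCell n i : Set (E d)) := by
  simp only [basicCell, ofPred_forall]
  exact MeasurableSet.iInter fun l =>
    measurableSet_Icc.preimage (by fun_prop : Measurable fun x : E d => x l)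

lemma measurableSet_cellSet (J : Finset (Fin d → ℕ)) :
    MeasurableSet (cellSet n J : Set (E d)) :=
  Finset.measurableSet_biUnion _ fun i _ => measurableSet_basicCell i

@[simp]
lemma cellSet_singleton (i : Fin d → ℕ) : (cellSet n {i} : Set (E d)) = basicCell n i := by
  simp [cellSet]

lemma mem_basicIndices {i : Fin d → ℕ} : i ∈ basicIndices d n ↔ ∀ l, i l < n := by
  simp [basicIndices]

lemma basicCell_subset_unitCube {i : Fin d → ℕ} (hi : i ∈ basicIndices d n) :
    basicCell n i ⊆ unitCube d := by
  intro x hx l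
  have hil : (i l : ℝ) + 1 ≤ n := by exact_mod_cast mem_basicIndices.1 hi l
  exact ⟨le_trans (by positivity) (hx l).1, (hx l).2.trans (div_le_one_of_le₀ hil (by positivity))⟩

lemma unitCube_subset_cellSet (hn : 0 < n) : unitCube d ⊆ cellSet n (basicIndices d n) := by
  intro x hx
  have hn' : (0 : ℝ) < n := by exact_mod_cast hn
  -- The minimum treats the face `x l = 1`, where the floor would be `n`.
  refine mem_iUnion₂.2 ⟨fun l => min ⌊n * x l⌋₊ (n - 1), mem_basicIndices.2 fun l => by omega,
    fun l => ?_⟩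
  obtain ⟨h0, h1⟩ := hx l
  have hnx : 0 ≤ n * x l := by positivity
  rw [mem_Icc, div_le_iff₀ hn', le_div_iff₀ hn', mul_comm (x l)]
  beta_reduce
  rcases le_total ⌊n * x l⌋₊ (n - 1) with h | h
  · rw [min_eq_left h]
    exact ⟨Nat.floor_le hnx, (Nat.lt_floor_add_one _).le⟩
  · rw [min_eq_right h]
    refine ⟨(Nat.cast_le.2 h).trans (Nat.floor_le hnx), ?_⟩
    have : ((n - 1 : ℕ) : ℝ) + 1 = n := by exact_mod_cast Nat.sub_add_cancel hn
    rw [this]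
    nlinarith

lemma compositeCell_subset (τ : Kind) (i : Fin d → ℕ) : compositeCell n τ i ⊆ basicIndices d n :=
  Finset.filter_subset _ _

lemma compositeCell_eq_iff {τ : Kind} {i j : Fin d → ℕ} (hj : j ∈ basicIndices d n) :
    compositeCell n τ j = compositeCell n τ i ↔ j ∈ compositeCell n τ i := by
  simp only [compositeCell, Finset.mem_filter, hj, true_and]
  constructor
  · intro h
    have : j ∈ (basicIndices d n).filter fun k => ∀ l, τ.label (k l) = τ.label (j l) := by
      simp [hj]
    rw [h, Finset.mem_filter] at this
    exact this.2
  · intro h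
    ext k
    simp [h]

lemma mem_compositeCell_self {τ : Kind} {i : Fin d → ℕ} (hi : i ∈ basicIndices d n) :
    i ∈ compositeCell n τ i :=
  (compositeCell_eq_iff hi).1 rfl

lemma compositeCell_mem_compositePartition {τ : Kind} {i : Fin d → ℕ}
    (hi : i ∈ basicIndices d n) : compositeCell n τ i ∈ compositePartition d n τ :=
  Finset.mem_image_of_mem _ hi

lemma subset_of_mem_compositePartition {τ : Kind} {J : Finset (Fin d → ℕ)}
    (hJ : J ∈ compositePartition d n τ) : J ⊆ basicIndices d n := by
  obtain ⟨i, -, rfl⟩ := Finset.mem_image.1 hJ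
  exact compositeCell_subset τ i

lemma compositeCell_eq_of_mem {τ : Kind} {J : Finset (Fin d → ℕ)}
    (hJ : J ∈ compositePartition d n τ) {i : Fin d → ℕ} (hi : i ∈ J) :
    compositeCell n τ i = J := by
  have hi' := subset_of_mem_compositePartition hJ hi
  obtain ⟨j, -, rfl⟩ := Finset.mem_image.1 hJ
  exact (compositeCell_eq_iff hi').2 hi

lemma disjoint_of_mem_compositePartition {τ : Kind} {J J' : Finset (Fin d → ℕ)}
    (hJ : J ∈ compositePartition d n τ) (hJ' : J' ∈ compositePartition d n τ) (h : J ≠ J') :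
    Disjoint J J' :=
  Finset.disjoint_left.2 fun _ hi hi' =>
    h ((compositeCell_eq_of_mem hJ hi).symm.trans (compositeCell_eq_of_mem hJ' hi'))

/-- Summation over the composite cells and their elements is summation over the basic cells. -/
lemma sum_compositePartition {M : Type*} [AddCommMonoid M] (τ : Kind)
    (F : Finset (Fin d → ℕ) → (Fin d → ℕ) → M) :
    ∑ J ∈ compositePartition d n τ, ∑ i ∈ J, F J i
      = ∑ i ∈ basicIndices d n, F (compositeCell n τ i) i := by
  rw [← Finset.sum_fiberwise_of_maps_to (t := compositePartition d n τ)
    (g := compositeCell n τ) fun i hi => compositeCell_mem_compositePartition hi]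
  refine Finset.sum_congr rfl fun J hJ => ?_
  have hfil : (basicIndices d n).filter (fun i => compositeCell n τ i = J) = J := by
    ext i
    rw [Finset.mem_filter]
    refine ⟨?_, fun hi => ⟨subset_of_mem_compositePartition hJ hi, compositeCell_eq_of_mem hJ hi⟩⟩
    rintro ⟨hi, rfl⟩
    exact mem_compositeCell_self hi
  conv_rhs => rw [hfil]
  exact Finset.sum_congr rfl fun i hi => by rw [compositeCell_eq_of_mem hJ hi]

lemma kindAt_succ (k : ℕ) : kindAt (k + 1) = (kindAt k).other := by
  unfold kindAt Kind.other
  by_cases h : Odd k <;> simp [Nat.odd_add_one, h]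

/-- For either kind, `n` times a coordinate of the center is `i l` or `i l + 1`, according to
parity. So the centers of both composite cells containing `i` are vertices of the basic cell `i`, at
distance `O(1/n)` from each other. -/
lemma cellCenter_mem_basicCell (τ : Kind) (i : Fin d → ℕ) :
    cellCenter n τ i ∈ basicCell n i := by
  intro l
  cases τ
  · have h1 : i l ≤ 2 * (i l / 2) + 1 := by omega
    have h2 : 2 * (i l / 2) ≤ i l := by omega
    simp only [cellCenter, Kind.label, mem_Icc]
    exact ⟨by gcongr; exact_mod_cast h1, by gcongr; exact_mod_cast h2⟩
  · have h1 : i l ≤ 2 * ((i l + 1) / 2) := by omega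
    have h2 : 2 * ((i l + 1) / 2) ≤ i l + 1 := by omega
    simp only [cellCenter, Kind.label, mem_Icc]
    exact ⟨by gcongr; exact_mod_cast h1, by gcongr; exact_mod_cast h2⟩

lemma cellCenter_eq_of_mem {τ : Kind} {i j : Fin d → ℕ} (h : j ∈ compositeCell n τ i) :
    cellCenter n τ j = cellCenter n τ i := by
  have hl := (Finset.mem_filter.1 h).2
  ext l
  cases τ <;> simp [cellCenter, hl l]

lemma dist_le_of_mem_basicCell {i : Fin d → ℕ} {x y : E d} (hx : x ∈ basicCell n i)
    (hy : y ∈ basicCell n i) : dist x y ≤ d / n := by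
  rw [dist_eq_norm, div_eq_mul_one_div]
  refine norm_le_of_coord_le _ (by positivity) fun l => ?_
  have h1 := hx l
  have h2 := hy l
  rw [mem_Icc, add_div] at h1 h2
  rw [PiLp.sub_apply, abs_le]
  constructor <;> linarith [h1.1, h1.2, h2.1, h2.2]

lemma dist_cellCenter_le {τ : Kind} {i : Fin d → ℕ} {x : E d}
    (hx : x ∈ cellSet n (compositeCell n τ i)) : dist x (cellCenter n τ i) ≤ d / n := by
  obtain ⟨j, hj, hxj⟩ := mem_iUnion₂.1 hx
  rw [← cellCenter_eq_of_mem hj]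
  exact dist_le_of_mem_basicCell hxj (cellCenter_mem_basicCell τ j)

end Cells

/-! ### Restriction of measures to cells -/

section Restrict

lemma restrict_biUnion_finset_ae {α ι : Type*} [MeasurableSpace α] {m : Measure α}
    {A : ι → Set α} (hA : ∀ i, MeasurableSet (A i)) (J : Finset ι)
    (hd : ∀ i ∈ J, ∀ j ∈ J, i ≠ j → m (A i ∩ A j) = 0) :
    m.restrict (⋃ i ∈ J, A i) = ∑ i ∈ J, m.restrict (A i) := by
  classical
  induction J using Finset.induction_on with
  | empty => simp
  | insert i J hi ih =>
    rw [Finset.set_biUnion_insert, Finset.sum_insert hi, ← ih fun a ha b hb =>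
      hd a (Finset.mem_insert_of_mem ha) b (Finset.mem_insert_of_mem hb)]
    refine Measure.restrict_union₀ ?_
      (Finset.measurableSet_biUnion _ fun i _ => hA i).nullMeasurableSet
    refine measure_mono_null (t := ⋃ j ∈ J, A i ∩ A j) (by rw [inter_iUnion₂]) ?_
    refine (measure_biUnion_null_iff J.countable_toSet).2 fun j hj => ?_
    exact hd i (Finset.mem_insert_self _ _) j (Finset.mem_insert_of_mem hj)
      (fun h => hi (h ▸ hj))

variable {d n : ℕ}

/-- The common boundaries of the basic cells carry no mass. -/
def NullOverlaps (n : ℕ) (m : Measure (E d)) : Prop :=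
  ∀ i ∈ basicIndices d n, ∀ j ∈ basicIndices d n, i ≠ j → m (basicCell n i ∩ basicCell n j) = 0

lemma restrict_cellSet {m : Measure (E d)} (hm : NullOverlaps n m)
    {J : Finset (Fin d → ℕ)} (hJ : J ⊆ basicIndices d n) :
    m.restrict (cellSet n J) = ∑ i ∈ J, m.restrict (basicCell n i) :=
  restrict_biUnion_finset_ae measurableSet_basicCell J fun i hi j hj => hm i (hJ hi) j (hJ hj)

lemma measure_cellSet {m : Measure (E d)} (hm : NullOverlaps n m)
    {J : Finset (Fin d → ℕ)} (hJ : J ⊆ basicIndices d n) :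
    m (cellSet n J) = ∑ i ∈ J, m (basicCell n i) := by
  simpa using congrArg (fun m => m univ) (restrict_cellSet hm hJ)

lemma restrict_cellSet_basicIndices {m : Measure (E d)} (hn : 0 < n)
    (hm : m (unitCube d)ᶜ = 0) : m.restrict (cellSet n (basicIndices d n)) = m :=
  Measure.restrict_eq_self_of_ae_mem <|
    measure_mono_null (compl_subset_compl.2 (unitCube_subset_cellSet hn)) hm

lemma sum_restrict_basicCell {m : Measure (E d)} (hn : 0 < n) (hm : NullOverlaps n m)
    (hm' : m (unitCube d)ᶜ = 0) : ∑ i ∈ basicIndices d n, m.restrict (basicCell n i) = m := by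
  rw [← restrict_cellSet hm Finset.Subset.rfl, restrict_cellSet_basicIndices hn hm']

lemma sum_restrict_compositePartition {m : Measure (E d)} (hn : 0 < n) (hm : NullOverlaps n m)
    (hm' : m (unitCube d)ᶜ = 0) (τ : Kind) :
    ∑ J ∈ compositePartition d n τ, m.restrict (cellSet n J) = m := by
  rw [Finset.sum_congr rfl fun J hJ => restrict_cellSet hm (subset_of_mem_compositePartition hJ),
    sum_compositePartition τ fun _ i => m.restrict (basicCell n i), sum_restrict_basicCell hn hm hm']

lemma measure_cellSet_inter {m : Measure (E d)} (hm : NullOverlaps n m) {τ : Kind}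
    {J J' : Finset (Fin d → ℕ)} (hJ : J ∈ compositePartition d n τ)
    (hJ' : J' ∈ compositePartition d n τ) (h : J ≠ J') :
    m (cellSet n J ∩ cellSet n J') = 0 := by
  refine measure_mono_null (t := ⋃ i ∈ J, ⋃ j ∈ J', basicCell n i ∩ basicCell n j) ?_ ?_
  · rintro x ⟨hx, hx'⟩
    obtain ⟨i, hi, hxi⟩ := mem_iUnion₂.1 hx
    obtain ⟨j, hj, hxj⟩ := mem_iUnion₂.1 hx'
    exact mem_iUnion₂.2 ⟨i, hi, mem_iUnion₂.2 ⟨j, hj, hxi, hxj⟩⟩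
  · refine (measure_biUnion_null_iff J.countable_toSet).2 fun i hi =>
      (measure_biUnion_null_iff J'.countable_toSet).2 fun j hj => ?_
    refine hm i (subset_of_mem_compositePartition hJ hi) j
      (subset_of_mem_compositePartition hJ' hj) ?_
    rintro rfl
    exact Finset.disjoint_left.1 (disjoint_of_mem_compositePartition hJ hJ' h) hi hj

/-- A measure that gives the basic cells the same masses as a probability measure without overlaps
has no overlaps. -/
lemma NullOverlaps.of_measure_eq {m m' : Measure (E d)} [IsProbabilityMeasure m]
    [IsProbabilityMeasure m'] (hn : 0 < n) (hm : NullOverlaps n m) (hms : m (unitCube d)ᶜ = 0)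
    (hms' : m' (unitCube d)ᶜ = 0)
    (h : ∀ i ∈ basicIndices d n, m (basicCell n i) = m' (basicCell n i)) : NullOverlaps n m' := by
  have hle : m' ≤ ∑ i ∈ basicIndices d n, m'.restrict (basicCell n i) := by
    conv_lhs => rw [← restrict_cellSet_basicIndices hn hms']
    refine Measure.le_iff.2 fun s hs => ?_
    rw [Measure.restrict_apply hs, Measure.finsetSum_apply, cellSet, inter_iUnion₂]
    exact (measure_biUnion_finset_le _ _).trans_eq
      (Finset.sum_congr rfl fun i _ => (Measure.restrict_apply hs).symm)
  -- The cells cover the cube, hence `≤`; both sides have total mass one, hence equality.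
  have heq : m' = ∑ i ∈ basicIndices d n, m'.restrict (basicCell n i) := by
    refine Measure.eq_of_le_of_measure_univ_eq hle ?_
    have h1 := congrArg (fun m => m univ) (sum_restrict_basicCell hn hm hms)
    simp only [Measure.finsetSum_apply, Measure.restrict_apply_univ, measure_univ] at h1 ⊢
    rw [← h1]
    exact Finset.sum_congr rfl h
  intro i hi j hj hij
  set A := (basicCell n i ∩ basicCell n j : Set (E d)) with hA
  have hAm : MeasurableSet A := (measurableSet_basicCell i).inter (measurableSet_basicCell j)
  have h2 : m' A = ∑ k ∈ basicIndices d n, m' (A ∩ basicCell n k) := by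
    conv_lhs => rw [heq]
    rw [Measure.finsetSum_apply]
    exact Finset.sum_congr rfl fun k _ => Measure.restrict_apply hAm
  -- The overlap `A` lies in the two cells `i` and `j`, so the sum counts it at least twice.
  have h3 : m' A + m' A ≤ m' A + 0 := by
    rw [add_zero]
    calc m' A + m' A = ∑ k ∈ {i, j}, m' (A ∩ basicCell n k) := by
          rw [Finset.sum_pair hij, inter_eq_left.2 inter_subset_left,
            inter_eq_left.2 inter_subset_right]
      _ ≤ ∑ k ∈ basicIndices d n, m' (A ∩ basicCell n k) :=
          Finset.sum_le_sum_of_subset (by simp [Finset.insert_subset_iff, hi, hj])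
      _ = m' A := h2.symm
  exact le_antisymm (ENNReal.le_of_add_le_add_left (measure_ne_top _ _) h3) zero_le

/-! ### Partial marginals -/

lemma snd_finsetSum {α β ι : Type*} [MeasurableSpace α] [MeasurableSpace β] (s : Finset ι)
    (P : ι → Measure (α × β)) : (∑ i ∈ s, P i).snd = ∑ i ∈ s, (P i).snd := by
  classical
  induction s using Finset.induction_on with
  | empty => simp
  | insert i s hi ih => rw [Finset.sum_insert hi, Finset.sum_insert hi, Measure.snd_add, ih]

lemma fst_finsetSum {α β ι : Type*} [MeasurableSpace α] [MeasurableSpace β] (s : Finset ι)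
    (P : ι → Measure (α × β)) : (∑ i ∈ s, P i).fst = ∑ i ∈ s, (P i).fst := by
  classical
  induction s using Finset.induction_on with
  | empty => simp
  | insert i s hi ih => rw [Finset.sum_insert hi, Finset.sum_insert hi, Measure.fst_add, ih]

lemma prod_univ_apply {α β : Type*} [MeasurableSpace α] [MeasurableSpace β]
    (P : Measure (α × β)) {s : Set α} (hs : MeasurableSet s) : P (s ×ˢ univ) = P.fst s := by
  rw [Measure.fst_apply hs, prod_univ]

lemma restrict_cellSet_prod {P : Measure (E d × E d)} (hP : NullOverlaps n P.fst)
    {J : Finset (Fin d → ℕ)} (hJ : J ⊆ basicIndices d n) :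
    P.restrict (cellSet n J ×ˢ univ) = ∑ i ∈ J, P.restrict (basicCell n i ×ˢ univ) := by
  rw [cellSet, iUnion₂_prod_const]
  refine restrict_biUnion_finset_ae (fun i => (measurableSet_basicCell i).prod .univ) J
    fun i hi j hj hij => ?_
  rw [prod_inter_prod, univ_inter,
    prod_univ_apply P ((measurableSet_basicCell i).inter (measurableSet_basicCell j))]
  exact hP i (hJ hi) j (hJ hj) hij

lemma sum_restrict_basicCell_prod {P : Measure (E d × E d)} (hn : 0 < n)
    (hP : NullOverlaps n P.fst) (hP' : P.fst (unitCube d)ᶜ = 0) :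
    ∑ i ∈ basicIndices d n, P.restrict (basicCell n i ×ˢ univ) = P := by
  rw [← restrict_cellSet_prod hP Finset.Subset.rfl]
  refine Measure.restrict_eq_self_of_ae_mem ?_
  have h : ∀ᵐ x ∂P.fst, x ∈ cellSet n (basicIndices d n) :=
    measure_mono_null (compl_subset_compl.2 (unitCube_subset_cellSet hn)) hP'
  filter_upwards [ae_of_ae_map measurable_fst.aemeasurable h] with p hp using ⟨hp, mem_univ _⟩

lemma partialMarginal_cellSet {P : Measure (E d × E d)} (hP : NullOverlaps n P.fst)
    {J : Finset (Fin d → ℕ)} (hJ : J ⊆ basicIndices d n) :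
    partialMarginal P (cellSet n J) = ∑ i ∈ J, partialMarginal P (basicCell n i) := by
  rw [partialMarginal, restrict_cellSet_prod hP hJ, snd_finsetSum]
  rfl

lemma partialMarginal_univ (P : Measure (E d × E d)) {s : Set (E d)} (hs : MeasurableSet s) :
    partialMarginal P s univ = P.fst s := by
  rw [partialMarginal, Measure.snd_univ, Measure.restrict_apply_univ, prod_univ_apply P hs]

lemma sum_partialMarginal_basicCell {P : Measure (E d × E d)} (hn : 0 < n)
    (hP : NullOverlaps n P.fst) (hP' : P.fst (unitCube d)ᶜ = 0) :
    ∑ i ∈ basicIndices d n, partialMarginal P (basicCell n i) = P.snd := by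
  conv_rhs => rw [← sum_restrict_basicCell_prod hn hP hP', snd_finsetSum]
  rfl

lemma partialMarginal_le (P : Measure (E d × E d)) (s : Set (E d)) :
    partialMarginal P s ≤ P.snd :=
  Measure.snd_mono Measure.restrict_le_self

/-- Properties of the plan assembled from couplings in the composite cells. -/
lemma coupling_sum_compositePartition {m : Measure (E d)} (hn : 0 < n) (hm : NullOverlaps n m)
    (hm' : m (unitCube d)ᶜ = 0) {P : Measure (E d × E d)} (hP : P.fst = m) {τ : Kind}
    {sol : Finset (Fin d → ℕ) → Measure (E d × E d)}
    (hsol : ∀ J ∈ compositePartition d n τ,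
      IsCoupling (sol J) (m.restrict (cellSet n J)) (partialMarginal P (cellSet n J))) :
    IsCoupling (∑ J ∈ compositePartition d n τ, sol J) m P.snd ∧
      ∀ J ∈ compositePartition d n τ,
        partialMarginal (∑ J ∈ compositePartition d n τ, sol J) (cellSet n J)
          = partialMarginal P (cellSet n J) := by
  refine ⟨⟨?_, ?_⟩, fun J hJ => ?_⟩
  · rw [fst_finsetSum, Finset.sum_congr rfl fun J hJ => (hsol J hJ).1,
      sum_restrict_compositePartition hn hm hm']
  · rw [snd_finsetSum, Finset.sum_congr rfl fun J hJ => (hsol J hJ).2.trans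
      (partialMarginal_cellSet (hP ▸ hm) (subset_of_mem_compositePartition hJ)),
      sum_compositePartition τ fun _ i => partialMarginal P (basicCell n i),
      sum_partialMarginal_basicCell hn (hP ▸ hm) (hP ▸ hm')]
  · have hmeas := measurableSet_cellSet (n := n) J
    have h1 : (∑ J' ∈ compositePartition d n τ, sol J').restrict (cellSet n J ×ˢ univ)
        = ∑ J' ∈ compositePartition d n τ, (sol J').restrict (cellSet n J ×ˢ univ) := by
      ext s hs
      simp [Measure.restrict_apply hs, Measure.finsetSum_apply]
    rw [partialMarginal, h1, Finset.sum_eq_single_of_mem J hJ, ← (hsol J hJ).2]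
    · congr 1
      refine Measure.restrict_eq_self_of_ae_mem ?_
      have h : ∀ᵐ x ∂(sol J).fst, x ∈ cellSet n J := by
        rw [(hsol J hJ).1]
        exact ae_restrict_mem hmeas
      filter_upwards [ae_of_ae_map measurable_fst.aemeasurable h] with p hp using ⟨hp, mem_univ _⟩
    -- The solution of another composite cell has first marginal `m` restricted to that cell, which
    -- does not charge `X_J`.
    · intro J' hJ' hne
      rw [Measure.restrict_eq_zero, prod_univ_apply _ hmeas, (hsol J' hJ').1,
        Measure.restrict_apply hmeas]
      exact measure_cellSet_inter hm hJ hJ' hne.symm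

end Restrict

/-! ### Marginals of the iterates and the decomposition of the discrete trajectory -/

namespace Setting

variable {d : ℕ} (S : Setting d) {n : ℕ}

lemma nullOverlaps_μn (hn : n ∈ levels) : NullOverlaps n (S.μn n : Measure (E d)) :=
  S.μn_overlap n hn

lemma nullOverlaps_μ (hn : n ∈ levels) : NullOverlaps n (S.μ : Measure (E d)) :=
  NullOverlaps.of_measure_eq hn.2 (S.nullOverlaps_μn hn) (S.μn_supp n hn) S.μ_supp
    (S.μn_cell n hn)

lemma iter_coupling (hn : n ∈ levels) (k : ℕ) :
    IsCoupling (S.iter n k : Measure (E d × E d)) (S.μn n) (S.νn n) := by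
  induction k with
  | zero =>
    have := (S.iter_run n hn).zero
    rw [this]
    exact S.πinitn_coupling n hn
  | succ k ih =>
    obtain ⟨sol, hsol, hsum⟩ := (S.iter_run n hn).step k
    rw [hsum]
    have := (coupling_sum_compositePartition hn.2 (S.nullOverlaps_μn hn) (S.μn_supp n hn) ih.1
      fun J hJ => (hsol J hJ).1).1
    rwa [ih.2] at this

/-- An iteration preserves the partial marginals of the composite cells on which it acts. -/
lemma cellMarginal_succ (hn : n ∈ levels) (k : ℕ) {J : Finset (Fin d → ℕ)}
    (hJ : J ∈ compositePartition d n (kindAt (k + 1))) :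
    S.cellMarginal n (k + 1) J = S.cellMarginal n k J := by
  obtain ⟨sol, hsol, hsum⟩ := (S.iter_run n hn).step k
  rw [cellMarginal, hsum]
  exact (coupling_sum_compositePartition hn.2 (S.nullOverlaps_μn hn) (S.μn_supp n hn)
    (S.iter_coupling hn k).1 fun J hJ => (hsol J hJ).1).2 J hJ

lemma nullOverlaps_iter (hn : n ∈ levels) (k : ℕ) :
    NullOverlaps n (S.iter n k : Measure (E d × E d)).fst := by
  rw [(S.iter_coupling hn k).1]
  exact S.nullOverlaps_μn hn

lemma iter_fst_compl_unitCube (hn : n ∈ levels) (k : ℕ) :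
    (S.iter n k : Measure (E d × E d)).fst (unitCube d)ᶜ = 0 := by
  rw [(S.iter_coupling hn k).1]
  exact S.μn_supp n hn

lemma cellMarginal_eq_sum (hn : n ∈ levels) (k : ℕ) {J : Finset (Fin d → ℕ)}
    (hJ : J ⊆ basicIndices d n) :
    S.cellMarginal n k J = ∑ i ∈ J, S.cellMarginal n k {i} := by
  simp only [cellMarginal, cellSet_singleton]
  exact partialMarginal_cellSet (S.nullOverlaps_iter hn k) hJ

lemma cellMarginal_compl (hn : n ∈ levels) (k : ℕ) (J : Finset (Fin d → ℕ)) :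
    S.cellMarginal n k J S.Yᶜ = 0 := by
  refine le_antisymm ((partialMarginal_le _ _ _).trans_eq ?_) zero_le
  rw [(S.iter_coupling hn k).2]
  exact S.νn_supp n hn

lemma sum_cellMarginal_univ (hn : n ∈ levels) (k : ℕ) :
    ∑ i ∈ basicIndices d n, S.cellMarginal n k {i} univ = 1 := by
  have h := congrArg (fun m => m univ) (sum_partialMarginal_basicCell hn.2
    (S.nullOverlaps_iter hn k) (S.iter_fst_compl_unitCube hn k))
  simpa [cellMarginal, Measure.finsetSum_apply, Measure.snd_univ] using h

lemma coe_mass (n : ℕ) (J : Finset (Fin d → ℕ)) :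
    (S.mass n J : ℝ≥0∞) = (S.μ : Measure (E d)) (cellSet n J) :=
  ENNReal.coe_toNNReal (measure_ne_top _ _)

lemma mass_ne_zero (hn : n ∈ levels) {i : Fin d → ℕ} (hi : i ∈ basicIndices d n) (τ : Kind) :
    S.mass n (compositeCell n τ i) ≠ 0 := by
  have h1 : basicCell n i ⊆ (cellSet n (compositeCell n τ i) : Set (E d)) :=
    subset_biUnion_of_mem (u := fun i => basicCell n i) (mem_compositeCell_self hi)
  have h2 := (S.μ_pos n hn i hi).trans_le (measure_mono h1)
  rw [← coe_mass] at h2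
  exact_mod_cast h2.ne'

/-- The iterates have first marginal `μ^n` while `mass` refers to `μ`. The two agree on unions of
basic cells, as neither charges the overlaps. -/
lemma cellMarginal_univ (hn : n ∈ levels) (k : ℕ) {J : Finset (Fin d → ℕ)}
    (hJ : J ⊆ basicIndices d n) : S.cellMarginal n k J univ = S.mass n J := by
  rw [cellMarginal, partialMarginal_univ _ (measurableSet_cellSet J), (S.iter_coupling hn k).1,
    coe_mass, measure_cellSet (S.nullOverlaps_μn hn) hJ, measure_cellSet (S.nullOverlaps_μ hn) hJ]
  exact Finset.sum_congr rfl fun i hi => S.μn_cell n hn i (hJ hi)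

/-- The contribution of the basic cell `i` to the discrete trajectory: its partial marginal is
spread out over the composite cell that contains it. -/
noncomputable def cellPlan (n k : ℕ) (i : Fin d → ℕ) : Measure (E d × E d) :=
  ((S.μ : Measure (E d)).restrict (cellSet n (compositeCell n (kindAt k) i))).prod
    ((S.mass n (compositeCell n (kindAt k) i))⁻¹ • S.cellMarginal n k {i})

instance (n k : ℕ) (i : Fin d → ℕ) : IsFiniteMeasure (S.cellPlan n k i) := by
  unfold cellPlan
  infer_instance

lemma prod_finsetSum {α β ι : Type*} [MeasurableSpace α] [MeasurableSpace β] (μ : Measure α)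
    [SFinite μ] (s : Finset ι) (ν : ι → Measure β) [∀ i, IsFiniteMeasure (ν i)] :
    μ.prod (∑ i ∈ s, ν i) = ∑ i ∈ s, μ.prod (ν i) := by
  classical
  induction s using Finset.induction_on with
  | empty => simp
  | insert i s hi ih => rw [Finset.sum_insert hi, Finset.sum_insert hi, Measure.prod_add, ih]

/-- The common form of trajectory and momentum: weights one give the former, the positive and
negative parts of `direction` the latter. -/
lemma weightedCells_eq (n k : ℕ) (w : (Fin d → ℕ) → ℝ≥0) :
    S.weightedCells n k w = ∑ i ∈ basicIndices d n, w i • S.cellPlan n k i := by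
  refine Eq.trans ?_ (sum_compositePartition (kindAt k) fun J i =>
    w i • ((S.μ : Measure (E d)).restrict (cellSet n J)).prod
      ((S.mass n J)⁻¹ • S.cellMarginal n k {i}))
  refine Finset.sum_congr rfl fun J _ => ?_
  rw [Finset.smul_sum, prod_finsetSum]
  refine Finset.sum_congr rfl fun i _ => ?_
  rw [smul_comm, Measure.prod_smul_right]

lemma discTrajectory_eq (hn : n ∈ levels) (t : ℝ) :
    S.discTrajectory n t = ∑ i ∈ basicIndices d n, S.cellPlan n ⌊(n : ℝ) * t⌋₊ i := by
  have h : S.discTrajectory n t = S.weightedCells n ⌊(n : ℝ) * t⌋₊ fun _ => 1 := by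
    refine Finset.sum_congr rfl fun J hJ => ?_
    simp_rw [S.cellMarginal_eq_sum hn _ (subset_of_mem_compositePartition hJ), one_smul]
  simp [h, weightedCells_eq]

lemma discTrajectory_fst (hn : n ∈ levels) (t : ℝ) : (S.discTrajectory n t).fst = S.μ := by
  rw [discTrajectory, fst_finsetSum]
  refine Eq.trans ?_ (sum_restrict_compositePartition hn.2 (S.nullOverlaps_μ hn) S.μ_supp
    (kindAt ⌊(n : ℝ) * t⌋₊))
  refine Finset.sum_congr rfl fun J hJ => ?_
  have hJ' := subset_of_mem_compositePartition hJ
  have hm : S.mass n J ≠ 0 := by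
    obtain ⟨i, hi, rfl⟩ := Finset.mem_image.1 hJ
    exact S.mass_ne_zero hn hi _
  have : IsProbabilityMeasure ((S.mass n J)⁻¹ • S.cellMarginal n ⌊(n : ℝ) * t⌋₊ J) := by
    refine ⟨?_⟩
    rw [Measure.smul_apply, S.cellMarginal_univ hn _ hJ', ENNReal.smul_def, smul_eq_mul]
    exact_mod_cast inv_mul_cancel₀ hm
  exact Measure.fst_prod

/-- The factor `1 / m_J` cancels the mass of `X_J`. This lets integrals in `y` against `ν_i` be
compared with integrals in `(x,y)` against `cellPlan`. -/
lemma cellPlan_snd (hn : n ∈ levels) (k : ℕ) {i : Fin d → ℕ} (hi : i ∈ basicIndices d n) :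
    (S.cellPlan n k i).snd = S.cellMarginal n k {i} := by
  have hm := S.mass_ne_zero hn hi (kindAt k)
  ext s hs
  rw [Measure.snd_apply hs, ← univ_prod, cellPlan, Measure.prod_prod, Measure.restrict_apply_univ,
    ← coe_mass, Measure.smul_apply, ENNReal.smul_def, smul_eq_mul, ← mul_assoc]
  norm_cast
  rw [mul_inv_cancel₀ hm, ENNReal.coe_one, one_mul]

lemma sum_cellPlan_real_univ (hn : n ∈ levels) (k : ℕ) :
    ∑ i ∈ basicIndices d n, (S.cellPlan n k i).real univ = 1 := by
  have h : ∑ i ∈ basicIndices d n, S.cellPlan n k i univ = 1 := by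
    rw [← S.sum_cellMarginal_univ hn k]
    exact Finset.sum_congr rfl fun i hi => by rw [← S.cellPlan_snd hn k hi, Measure.snd_univ]
  rw [← ENNReal.toReal_one, ← h, ENNReal.toReal_sum fun _ _ => measure_ne_top _ _]
  rfl

lemma ae_cellPlan (hn : n ∈ levels) (k : ℕ) {i : Fin d → ℕ} (hi : i ∈ basicIndices d n) :
    ∀ᵐ q ∂(S.cellPlan n k i),
      q.1 ∈ cellSet n (compositeCell n (kindAt k) i) ∧ q.1 ∈ unitCube d ∧ q.2 ∈ S.Y := by
  have h1 : ∀ᵐ q ∂(S.cellPlan n k i), q.1 ∈ cellSet n (compositeCell n (kindAt k) i) :=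
    Measure.quasiMeasurePreserving_fst.ae (ae_restrict_mem (measurableSet_cellSet _))
  have h2 : ∀ᵐ y ∂(S.cellPlan n k i).snd, y ∈ S.Y := by
    rw [S.cellPlan_snd hn k hi]
    exact S.cellMarginal_compl hn k {i}
  filter_upwards [h1, ae_of_ae_map measurable_snd.aemeasurable h2] with q hq hq2
  refine ⟨hq, ?_, hq2⟩
  obtain ⟨j, hj, hqj⟩ := mem_iUnion₂.1 hq
  exact basicCell_subset_unitCube (compositeCell_subset _ _ hj) hqj

lemma ae_cellMarginal (hn : n ∈ levels) (k : ℕ) (J : Finset (Fin d → ℕ)) :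
    ∀ᵐ y ∂(S.cellMarginal n k J), y ∈ S.Y :=
  S.cellMarginal_compl hn k J

end Setting

/-! ### The vertical transport metric -/

variable {d : ℕ}

/-- Half of Kantorovich duality: the bound on `h y - h y'` is integrated against any coupling. The
slack `δ` admits continuous functions that are not Lipschitz, such as derivatives of a `C¹`
function. -/
lemma enorm_integral_sub_le_wasserstein1 {ρ ρ' : Measure (E d)} [IsProbabilityMeasure ρ]
    [IsProbabilityMeasure ρ'] {h : E d → ℝ} (hc : Continuous h) {M : ℝ} (hM : ∀ y, ‖h y‖ ≤ M)
    {δ C : ℝ} (hδ : 0 ≤ δ) (hC : 0 < C) (hδC : ∀ y y', |h y - h y'| ≤ δ + C * dist y y') :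
    ‖∫ y, h y ∂ρ - ∫ y, h y ∂ρ'‖ₑ
      ≤ ENNReal.ofReal δ + ENNReal.ofReal C * wasserstein1 ρ ρ' := by
  -- The Wasserstein distance is isolated so that the infimum can be bounded coupling by coupling.
  rw [← tsub_le_iff_left, mul_comm, ← ENNReal.div_le_iff (by simpa using hC) ENNReal.ofReal_ne_top]
  refine le_iInf₂ fun γ hγ => ?_
  rw [ENNReal.div_le_iff (by simpa using hC) ENNReal.ofReal_ne_top, tsub_le_iff_left, mul_comm]
  have hγ1 : γ univ = 1 := by rw [← Measure.fst_univ, hγ.1, measure_univ]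
  have : IsProbabilityMeasure γ := ⟨hγ1⟩
  have h1 : ∫ y, h y ∂ρ = ∫ p, h p.1 ∂γ := by
    rw [← hγ.1, Measure.fst, integral_map measurable_fst.aemeasurable hc.aestronglyMeasurable]
  have h2 : ∫ y, h y ∂ρ' = ∫ p, h p.2 ∂γ := by
    rw [← hγ.2, Measure.snd, integral_map measurable_snd.aemeasurable hc.aestronglyMeasurable]
  have i1 : Integrable (fun p : E d × E d => h p.1) γ :=
    Integrable.of_bound (hc.comp continuous_fst).aestronglyMeasurable M
      (Eventually.of_forall fun p => hM p.1)
  have i2 : Integrable (fun p : E d × E d => h p.2) γ :=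
    Integrable.of_bound (hc.comp continuous_snd).aestronglyMeasurable M
      (Eventually.of_forall fun p => hM p.2)
  rw [h1, h2, ← integral_sub i1 i2]
  calc ‖∫ p, (h p.1 - h p.2) ∂γ‖ₑ ≤ ∫⁻ p, ‖h p.1 - h p.2‖ₑ ∂γ :=
        enorm_integral_le_lintegral_enorm _
    _ ≤ ∫⁻ p, (ENNReal.ofReal δ + ENNReal.ofReal C * edist p.1 p.2) ∂γ := by
        refine lintegral_mono fun p => ?_
        rw [Real.enorm_eq_ofReal_abs, edist_dist, ← ENNReal.ofReal_mul hC.le,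
          ← ENNReal.ofReal_add hδ (by positivity)]
        exact ENNReal.ofReal_le_ofReal (hδC _ _)
    _ = ENNReal.ofReal δ + ENNReal.ofReal C * ∫⁻ p, edist p.1 p.2 ∂γ := by
        rw [lintegral_add_left measurable_const, lintegral_const_mul' _ _ ENNReal.ofReal_ne_top, lintegral_const,
          hγ1, mul_one]

lemma enorm_integral_sub_le_verticalDist {μ : Measure (E d)} [IsProbabilityMeasure μ]
    {π π' : Measure (E d × E d)} [IsFiniteMeasure π] [IsFiniteMeasure π'] (hπ : π.fst = μ)
    (hπ' : π'.fst = μ) {g : E d × E d → ℝ} (hc : Continuous g) {M : ℝ} (hM : ∀ q, ‖g q‖ ≤ M)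
    {δ C : ℝ} (hδ : 0 ≤ δ) (hC : 0 < C) (hδC : ∀ p q, |g p - g q| ≤ δ + C * dist p q) :
    ‖∫ q, g q ∂π - ∫ q, g q ∂π'‖ₑ
      ≤ ENNReal.ofReal δ + ENNReal.ofReal C * verticalDist μ π π' := by
  have key : ∀ (m : Measure (E d × E d)) [IsFiniteMeasure m], m.fst = μ →
      Integrable (fun x => ∫ y, g (x, y) ∂(m.condKernel x)) μ ∧
        ∫ q, g q ∂m = ∫ x, ∫ y, g (x, y) ∂(m.condKernel x) ∂μ := fun m _ hm => by
    have hi : Integrable g (m.fst ⊗ₘ m.condKernel) :=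
      Integrable.of_bound hc.aestronglyMeasurable M (Eventually.of_forall hM)
    refine ⟨hm ▸ Integrable.integral_compProd hi, ?_⟩
    rw [← hm, ← Measure.integral_compProd hi, m.disintegrate]
  obtain ⟨i1, h1⟩ := key π hπ
  obtain ⟨i2, h2⟩ := key π' hπ'
  rw [h1, h2, ← integral_sub i1 i2]
  calc _ ≤ ∫⁻ x, ‖∫ y, g (x, y) ∂(π.condKernel x) - ∫ y, g (x, y) ∂(π'.condKernel x)‖ₑ ∂μ :=
        enorm_integral_le_lintegral_enorm _
    _ ≤ ∫⁻ x, (ENNReal.ofReal δ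
          + ENNReal.ofReal C * wasserstein1 (π.condKernel x) (π'.condKernel x)) ∂μ := by
        refine lintegral_mono fun x => ?_
        refine enorm_integral_sub_le_wasserstein1 (by fun_prop) (fun y => hM (x, y)) hδ hC
          fun y y' => ?_
        simpa [Prod.dist_eq] using hδC (x, y) (x, y')
    _ = ENNReal.ofReal δ + ENNReal.ofReal C * verticalDist μ π π' := by
        -- Constants are pulled out in a form that asks for no measurability of `x ↦ W_Y(π_x,
        -- π'_x)`.
        rw [lintegral_add_left measurable_const, lintegral_const_mul' _ _ ENNReal.ofReal_ne_top, lintegral_const,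
          measure_univ, mul_one, verticalDist]

/-- Convergence in the vertical transport metric implies weak convergence. -/
lemma tendsto_integral_of_verticalDist {ι : Type*} {F : Filter ι} {μ : Measure (E d)}
    [IsProbabilityMeasure μ] {P : ι → Measure (E d × E d)} [∀ i, IsFiniteMeasure (P i)]
    {π : Measure (E d × E d)} [IsFiniteMeasure π] (hP : ∀ᶠ i in F, (P i).fst = μ)
    (hπ : π.fst = μ) (hlim : Tendsto (fun i => verticalDist μ (P i) π) F (𝓝 0))
    {g : E d × E d → ℝ} (hc : Continuous g) {M : ℝ} (hM : ∀ q, ‖g q‖ ≤ M)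
    (hg : ∀ δ > 0, ∃ C : ℝ, 0 < C ∧ ∀ p q, |g p - g q| ≤ δ + C * dist p q) :
    Tendsto (fun i => ∫ q, g q ∂(P i)) F (𝓝 (∫ q, g q ∂π)) := by
  rw [Metric.tendsto_nhds]
  intro ε hε
  obtain ⟨C, hC, hδC⟩ := hg (ε / 2) (half_pos hε)
  have hlim' : Tendsto (fun i => ENNReal.ofReal C * verticalDist μ (P i) π) F (𝓝 0) := by
    simpa using ENNReal.Tendsto.const_mul hlim (Or.inr ENNReal.ofReal_ne_top)
  have hev := hlim'.eventually_lt_const (u := ENNReal.ofReal (ε / 2)) (by simpa using hε)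
  filter_upwards [hP, hev] with i hi hlt
  have h1 := enorm_integral_sub_le_verticalDist hi hπ hc hM (half_pos hε).le hC hδC
  have h2 : ENNReal.ofReal (ε / 2) + ENNReal.ofReal C * verticalDist μ (P i) π
      < ENNReal.ofReal ε := by
    conv_rhs => rw [← add_halves ε, ENNReal.ofReal_add (half_pos hε).le (half_pos hε).le]
    exact ENNReal.add_lt_add_left ENNReal.ofReal_ne_top hlt
  rw [Real.enorm_eq_ofReal_abs] at h1
  rw [Real.dist_eq]
  exact (ENNReal.ofReal_lt_ofReal_iff hε).1 (h1.trans_lt h2)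

/-! ### Local expansion of a test function along the discrete dynamics -/

lemma clm_apply_prod_eq_sum (L : ℝ × E d →L[ℝ] ℝ) (s : ℝ) (v : E d) :
    L (s, v) = s * L (1, 0) + ∑ l, v l * L (0, EuclideanSpace.single l 1) := by
  have hv : v = ∑ l, v l • EuclideanSpace.single l (1 : ℝ) := by
    simpa using ((EuclideanSpace.basisFun (Fin d) ℝ).sum_repr v).symm
  have h1 : L (s, v) = s • L (1, 0) + L.comp (ContinuousLinearMap.inr ℝ ℝ (E d)) v := by
    rw [← map_smul, ContinuousLinearMap.comp_apply, ← map_add]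
    simp
  rw [h1]
  conv_lhs => rw [hv, map_sum]
  simp

lemma eventually_along_iff {Z : Set ℕ} {p : ℕ → Prop} :
    (∀ᶠ n in along Z, p n) ↔ ∀ᶠ n in atTop, n ∈ Z → p n :=
  eventually_inf_principal

lemma eventually_mem_along (Z : Set ℕ) : ∀ᶠ n in along Z, n ∈ Z :=
  eventually_along_iff.2 (Eventually.of_forall fun _ h => h)

lemma eventually_const_div_lt_along (Z : Set ℕ) (C : ℝ) {r : ℝ} (hr : 0 < r) :
    ∀ᶠ n : ℕ in along Z, C / n < r :=
  ((tendsto_const_div_atTop_nhds_zero_nat C).mono_left inf_le_left).eventually_lt_const hr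

/-- The increment in `(t,x)` is `(1/n, x_{Ĵ(i)} - x_J)`, and `n` times it is `(1, direction)`. The
derivative may be taken at any `(t,x)` of the slice and cell, which is what a trajectory spread over
`X_J` and over the slice requires. -/
lemma IsTestFunction.eventually_abs_sub_le {Y : Set (E d)} {φ : ℝ × E d × E d → ℝ}
    (hφ : IsTestFunction Y φ) (hY : IsCompact Y) (T : ℕ) {δ : ℝ} (hδ : 0 < δ) :
    ∀ᶠ n in along levels, ∀ k < n * T, ∀ i ∈ basicIndices d n,
      ∀ t ∈ Ico ((k : ℝ) / n) (((k : ℝ) + 1) / n), ∀ x ∈ unitCube d,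
      x ∈ cellSet n (compositeCell n (kindAt k) i) → ∀ y ∈ Y,
      |timeDeriv φ (t, x, y) + ∑ l, Setting.direction n k i l * spaceDeriv φ l (t, x, y)
        - n * (φ (((k : ℝ) + 1) / n, cellCenter n (kindAt (k + 1)) i, y)
          - φ ((k : ℝ) / n, cellCenter n (kindAt k) i, y))| ≤ δ := by
  -- The increment has norm at most `(d + 1) / n`, so after multiplication by `n` the error is `δ`.
  -- All three points lie within `2 * (d + 1) / n` of `(t,x)`.
  obtain ⟨r, hr, hT⟩ := hφ.exists_taylor hY T (δ := δ / (d + 1)) (by positivity)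
  filter_upwards [eventually_mem_along levels,
    eventually_const_div_lt_along levels (2 * (d + 1)) hr] with n hn hnr
  intro k hk i hi t ht x hx hxJ y hy
  have hn0 : (0 : ℝ) < n := by exact_mod_cast hn.2
  set a := cellCenter n (kindAt k) i with ha
  set b := cellCenter n (kindAt (k + 1)) i with hb
  have hai : a ∈ basicCell n i := cellCenter_mem_basicCell _ i
  have hbi : b ∈ basicCell n i := cellCenter_mem_basicCell _ i
  have hxa : dist x a ≤ d / n := dist_cellCenter_le hxJ
  have hba : dist b a ≤ d / n := dist_le_of_mem_basicCell hbi hai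
  have hbx : dist b x ≤ d / n + d / n :=
    (dist_triangle b a x).trans (add_le_add hba (by rwa [dist_comm]))
  have hk0 : (0 : ℝ) ≤ k / n := by positivity
  have hkT : ((k : ℝ) + 1) / n ≤ T := by
    rw [div_le_iff₀ hn0, mul_comm]
    exact_mod_cast hk
  have hkk : ((k : ℝ) + 1) / n = k / n + 1 / n := add_div _ _ _
  have h1n : (0 : ℝ) < 1 / n := by positivity
  have hdn : (0 : ℝ) ≤ d / n := by positivity
  have hr' : 2 * ((d : ℝ) / n) + 2 * (1 / n) < r := by
    convert hnr using 1
    ring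
  have hrad : (d : ℝ) / n + 1 / n < r := by linarith
  have ht1 := ht.1
  have ht2 := ht.2
  have hmain := hT y hy (t, x) ((k : ℝ) / n, a) (((k : ℝ) + 1) / n, b) (by
    rintro w (rfl | rfl | rfl)
    · exact ⟨⟨⟨by linarith, by linarith⟩, hx⟩, by simpa using hr⟩
    · refine ⟨⟨⟨hk0, by linarith⟩, basicCell_subset_unitCube hi hai⟩, max_lt ?_ ?_⟩
      · rw [Real.dist_eq, abs_lt]
        constructor <;> simp only <;> linarith
      · rw [dist_comm]
        simp only
        linarith
    · refine ⟨⟨⟨by simp only; linarith, hkT⟩, basicCell_subset_unitCube hi hbi⟩, max_lt ?_ ?_⟩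
      · rw [Real.dist_eq, abs_lt]
        constructor <;> simp only <;> linarith
      · simp only
        linarith)
  have hnorm : ‖(((k : ℝ) + 1) / n, b) - ((k : ℝ) / n, a)‖ ≤ (d + 1) / n := by
    rw [Prod.mk_sub_mk, hkk, add_sub_cancel_left, add_div (d : ℝ)]
    refine max_le ?_ ?_
    · rw [Real.norm_eq_abs, abs_of_pos h1n]
      linarith
    · simp only [← dist_eq_norm]
      linarith
  have hlin : n * derivTX φ (t, x, y) ((((k : ℝ) + 1) / n, b) - ((k : ℝ) / n, a))
      = timeDeriv φ (t, x, y) + ∑ l, Setting.direction n k i l * spaceDeriv φ l (t, x, y) := by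
    rw [Prod.mk_sub_mk, clm_apply_prod_eq_sum, hkk, add_sub_cancel_left, mul_add, ← mul_assoc,
      mul_one_div_cancel hn0.ne', one_mul, Finset.mul_sum]
    simp only [timeDeriv, spaceDeriv, Setting.direction, ← kindAt_succ, ← ha, ← hb, PiLp.sub_apply,
      mul_assoc]
  rw [← hlin, ← mul_sub, abs_mul, abs_of_pos hn0, abs_sub_comm]
  calc _ ≤ n * (δ / (d + 1) * ((d + 1) / n)) := by
        refine mul_le_mul_of_nonneg_left (hmain.trans ?_) hn0.le
        exact mul_le_mul_of_nonneg_left hnorm (by positivity)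
    _ = δ := by field_simp

/-! ### Integrals of test functions -/

lemma continuous_integral_slice {α : Type*} [TopologicalSpace α] [MeasurableSpace α]
    [OpensMeasurableSpace α] [SecondCountableTopology α] (A : Measure α) [IsFiniteMeasure A]
    {G : ℝ × α → ℝ} (hG : Continuous G) {M : ℝ} (hM : ∀ p, ‖G p‖ ≤ M) :
    Continuous fun t => ∫ q, G (t, q) ∂A :=
  continuous_of_dominated (bound := fun _ => M)
    (fun t => (hG.comp (by fun_prop : Continuous fun q : α => (t, q))).aestronglyMeasurable)
    (fun _ => Eventually.of_forall fun _ => hM _) (integrable_const M)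
    (Eventually.of_forall fun _ => by fun_prop)

lemma integrable_of_continuous_of_bound {α : Type*} [TopologicalSpace α] [MeasurableSpace α]
    [OpensMeasurableSpace α] [SecondCountableTopology α] (A : Measure α) [IsFiniteMeasure A]
    {g : α → ℝ} (hg : Continuous g) {M : ℝ} (hM : ∀ p, ‖g p‖ ≤ M) : Integrable g A :=
  Integrable.of_bound hg.aestronglyMeasurable M (Eventually.of_forall hM)

/-! ### The telescoping quantity and integrals against the discrete measures -/

namespace Setting

variable (S : Setting d) {n : ℕ}

/-- The value at time `k / n` of the quantity which telescopes along the iterations: the integral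
of `G (k / n, x_J, y)` against the partial marginals of iteration `k`. -/
noncomputable def cellSum (G : ℝ × E d × E d → ℝ) (n k : ℕ) : ℝ :=
  ∑ i ∈ basicIndices d n,
    ∫ y, G ((k : ℝ) / n, cellCenter n (kindAt k) i, y) ∂(S.cellMarginal n k {i})

lemma integral_cellMarginal_eq_sum (hn : n ∈ levels) (k : ℕ) {J : Finset (Fin d → ℕ)}
    (hJ : J ⊆ basicIndices d n) {g : E d → ℝ} (hg : Continuous g) {M : ℝ}
    (hM : ∀ y, ‖g y‖ ≤ M) :
    ∫ y, g y ∂(S.cellMarginal n k J) = ∑ i ∈ J, ∫ y, g y ∂(S.cellMarginal n k {i}) := by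
  rw [S.cellMarginal_eq_sum hn k hJ, integral_finsetSum_measure fun i _ =>
    integrable_of_continuous_of_bound _ hg hM]

/-- After regrouping over the cells `J` of the new partition, the integrand is constant in `i ∈ J`,
so only `ν_J^{n,k+1} = ν_J^{n,k}` enters. -/
lemma cellSum_succ (hn : n ∈ levels) (k : ℕ) {G : ℝ × E d × E d → ℝ} (hG : Continuous G)
    {M : ℝ} (hM : ∀ p, ‖G p‖ ≤ M) :
    S.cellSum G n (k + 1) = ∑ i ∈ basicIndices d n,
      ∫ y, G (((k : ℝ) + 1) / n, cellCenter n (kindAt (k + 1)) i, y) ∂(S.cellMarginal n k {i}) := by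
  rw [cellSum, Nat.cast_add_one]
  rw [← sum_compositePartition (kindAt (k + 1)) fun _ i =>
      ∫ y, G (((k : ℝ) + 1) / n, cellCenter n (kindAt (k + 1)) i, y)
        ∂(S.cellMarginal n (k + 1) {i}),
    ← sum_compositePartition (kindAt (k + 1)) fun _ i =>
      ∫ y, G (((k : ℝ) + 1) / n, cellCenter n (kindAt (k + 1)) i, y) ∂(S.cellMarginal n k {i})]
  refine Finset.sum_congr rfl fun J hJ => ?_
  have hsub := subset_of_mem_compositePartition hJ
  obtain ⟨j, -, hj⟩ := Finset.mem_image.1 hJ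
  have hcenter : ∀ i ∈ J, cellCenter n (kindAt (k + 1)) i = cellCenter n (kindAt (k + 1)) j :=
    fun i hi => cellCenter_eq_of_mem (hj ▸ hi)
  have hsum : ∀ m, ∑ i ∈ J, ∫ y, G (((k : ℝ) + 1) / n, cellCenter n (kindAt (k + 1)) i, y)
      ∂(S.cellMarginal n m {i})
      = ∫ y, G (((k : ℝ) + 1) / n, cellCenter n (kindAt (k + 1)) j, y) ∂(S.cellMarginal n m J) :=
    fun m => by
      rw [S.integral_cellMarginal_eq_sum hn m hsub (M := M) (by fun_prop) fun y => hM _]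
      exact Finset.sum_congr rfl fun i hi => by rw [hcenter i hi]
  rw [hsum, hsum, S.cellMarginal_succ hn k hJ]

lemma integral_cellMarginal_eq_cellPlan (hn : n ∈ levels) (k : ℕ) {i : Fin d → ℕ}
    (hi : i ∈ basicIndices d n) {g : E d → ℝ} (hg : Continuous g) :
    ∫ y, g y ∂(S.cellMarginal n k {i}) = ∫ q, g q.2 ∂(S.cellPlan n k i) := by
  rw [← S.cellPlan_snd hn k hi, Measure.snd,
    integral_map measurable_snd.aemeasurable hg.aestronglyMeasurable]

lemma ae_weightedCells (hn : n ∈ levels) (k : ℕ) (w : (Fin d → ℕ) → ℝ≥0) :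
    ∀ᵐ q ∂(S.weightedCells n k w), q.1 ∈ unitCube d ∧ q.2 ∈ S.Y := by
  rw [weightedCells_eq]
  refine ae_finsetSum_measure_iff.2 fun i hi => ?_
  have h : ∀ᵐ q ∂(S.cellPlan n k i), q.1 ∈ unitCube d ∧ q.2 ∈ S.Y :=
    (S.ae_cellPlan hn k hi).mono fun q hq => hq.2
  exact Measure.ae_smul_measure h (w i)

instance (n k : ℕ) (w : (Fin d → ℕ) → ℝ≥0) : IsFiniteMeasure (S.weightedCells n k w) := by
  rw [weightedCells_eq]
  infer_instance

lemma integral_weightedCells (n k : ℕ) (w : (Fin d → ℕ) → ℝ≥0) {g : E d × E d → ℝ}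
    (hg : Continuous g) {M : ℝ} (hM : ∀ q, ‖g q‖ ≤ M) :
    ∫ q, g q ∂(S.weightedCells n k w)
      = ∑ i ∈ basicIndices d n, w i * ∫ q, g q ∂(S.cellPlan n k i) := by
  rw [weightedCells_eq, integral_finsetSum_measure fun i _ =>
    integrable_of_continuous_of_bound _ hg hM]
  simp [integral_smul_nnreal_measure, NNReal.smul_def]

/-- Integration against a measure of the kind of the positive or negative part of the momentum. -/
lemma integral_sum_weightedCells (hn : n ∈ levels) (w : ℕ → (Fin d → ℕ) → ℝ≥0)
    {G : ℝ × E d × E d → ℝ} (hG : Continuous G) {M : ℝ} (hM : ∀ p, ‖G p‖ ≤ M) {T : ℕ}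
    (hT : ∀ p ∈ spaceTime S.Y, (T : ℝ) ≤ p.1 → G p = 0) :
    ∫ p, G p ∂((Measure.sum fun k : ℕ =>
        (volume.restrict (Ico ((k : ℝ) / n) (((k : ℝ) + 1) / n))).prod
          (S.weightedCells n k (w k))).restrict (Icc (0 : ℝ) T ×ˢ univ))
      = ∑ k ∈ Finset.range (n * T), ∫ t in Ico ((k : ℝ) / n) (((k : ℝ) + 1) / n),
          ∑ i ∈ basicIndices d n, w k i * ∫ q, G (t, q) ∂(S.cellPlan n k i) := by
  have hn0 : (0 : ℝ) < n := by exact_mod_cast hn.2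
  set m : ℕ → Measure (ℝ × E d × E d) := fun k =>
    (volume.restrict (Ico ((k : ℝ) / n) (((k : ℝ) + 1) / n))).prod (S.weightedCells n k (w k))
    with hm
  have hae : ∀ k : ℕ, ∀ᵐ p ∂(m k), p.1 ∈ Ico ((k : ℝ) / n) (((k : ℝ) + 1) / n) ∧
      p ∈ spaceTime S.Y := fun k => by
    have h1 : ∀ᵐ p ∂(m k), p.1 ∈ Ico ((k : ℝ) / n) (((k : ℝ) + 1) / n) :=
      Measure.quasiMeasurePreserving_fst.ae (ae_restrict_mem measurableSet_Ico)
    have h2 : ∀ᵐ p ∂(m k), p.2.1 ∈ unitCube d ∧ p.2.2 ∈ S.Y :=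
      Measure.quasiMeasurePreserving_snd.ae (S.ae_weightedCells hn k (w k))
    filter_upwards [h1, h2] with p hp1 hp2
    exact ⟨hp1, (by positivity : (0 : ℝ) ≤ k / n).trans hp1.1, hp2⟩
  have hout : ∀ᵐ p ∂(Measure.sum m), p ∉ Icc (0 : ℝ) T ×ˢ (univ : Set (E d × E d)) → G p = 0 := by
    refine Measure.ae_sum_iff.2 fun k => (hae k).mono fun p hp hpT => hT p hp.2 ?_
    by_contra hlt
    exact hpT ⟨⟨hp.2.1, (not_le.1 hlt).le⟩, mem_univ _⟩
  -- Slices `k ≥ n * T` lie at times at least `T`, where `G` vanishes. Only finitely many slices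
  -- remain, which also settles integrability.
  have htail : G =ᵐ[Measure.sum fun k : ↥((Finset.range (n * T) : Set ℕ)ᶜ) => m k] 0 := by
    refine Measure.ae_sum_iff.2 fun ⟨k, hk⟩ => (hae k).mono fun p hp => hT p hp.2 (le_trans ?_ hp.1.1)
    rw [le_div_iff₀ hn0, mul_comm]
    simp only [mem_compl_iff, Finset.mem_coe, Finset.mem_range, not_lt] at hk
    exact_mod_cast hk
  have hfin : ∀ k, Integrable G (m k) := fun k => integrable_of_continuous_of_bound _ hG hM
  have hsplit : Measure.sum m = ∑ k ∈ Finset.range (n * T), m k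
      + Measure.sum fun k : ↥((Finset.range (n * T) : Set ℕ)ᶜ) => m k := by
    rw [← Measure.sum_coe_finset]
    exact (Measure.sum_add_sum_compl _ m).symm
  rw [setIntegral_eq_integral_of_ae_compl_eq_zero hout, hsplit,
    integral_add_measure (integrable_finsetSum_measure.2 fun k _ => hfin k)
      ((integrable_congr htail).2 (integrable_zero _ _ _)),
    integral_congr_ae htail]
  simp only [Pi.zero_apply, integral_zero, add_zero]
  rw [integral_finsetSum_measure fun k _ => hfin k]
  refine Finset.sum_congr rfl fun k _ => ?_
  rw [integral_prod _ (hfin k)]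
  refine integral_congr_ae (Eventually.of_forall fun t => ?_)
  exact S.integral_weightedCells n k (w k) (hG.comp (Continuous.prodMk_right t)) fun q => hM (t, q)

lemma discMomentum_integral (hn : n ∈ levels) (l : Fin d)
    {G : ℝ × E d × E d → ℝ} (hG : Continuous G) {M : ℝ} (hM : ∀ p, ‖G p‖ ≤ M) {T : ℕ}
    (hT : ∀ p ∈ spaceTime S.Y, (T : ℝ) ≤ p.1 → G p = 0) :
    ((S.discMomentum n l).upTo T).integral G
      = ∑ k ∈ Finset.range (n * T), ∫ t in Ico ((k : ℝ) / n) (((k : ℝ) + 1) / n),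
          ∑ i ∈ basicIndices d n, direction n k i l * ∫ q, G (t, q) ∂(S.cellPlan n k i) := by
  have hint : ∀ (k : ℕ) (w : (Fin d → ℕ) → ℝ), IntegrableOn
      (fun t => ∑ i ∈ basicIndices d n, w i * ∫ q, G (t, q) ∂(S.cellPlan n k i))
      (Ico ((k : ℝ) / n) (((k : ℝ) + 1) / n)) := fun k w =>
    (Continuous.integrableOn_Icc (continuous_finsetSum _ fun i _ =>
      continuous_const.mul (continuous_integral_slice _ hG hM))).mono_set Ico_subset_Icc_self
  rw [SignedPair.integral, SignedPair.upTo, discMomentum]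
  simp only
  rw [S.integral_sum_weightedCells hn _ hG hM hT, S.integral_sum_weightedCells hn _ hG hM hT,
    ← Finset.sum_sub_distrib]
  refine Finset.sum_congr rfl fun k _ => ?_
  rw [← integral_sub (hint k _) (hint k _)]
  refine integral_congr_ae (Eventually.of_forall fun t => ?_)
  simp only [← Finset.sum_sub_distrib, ← sub_mul]
  refine Finset.sum_congr rfl fun i _ => ?_
  congr 1
  simp only [Real.coe_toNNReal']
  exact max_zero_sub_max_neg_zero_eq_self _

lemma integral_discTrajectory (hn : n ∈ levels) (t : ℝ) {g : E d × E d → ℝ}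
    (hg : Continuous g) {M : ℝ} (hM : ∀ q, ‖g q‖ ≤ M) :
    ∫ q, g q ∂(S.discTrajectory n t)
      = ∑ i ∈ basicIndices d n, ∫ q, g q ∂(S.cellPlan n ⌊(n : ℝ) * t⌋₊ i) := by
  rw [S.discTrajectory_eq hn, integral_finsetSum_measure fun i _ =>
    integrable_of_continuous_of_bound _ hg hM]

lemma measurable_integral_discTrajectory (hn : n ∈ levels) {G : ℝ × E d × E d → ℝ}
    (hG : Continuous G) {M : ℝ} (hM : ∀ p, ‖G p‖ ≤ M) :
    Measurable fun t => ∫ q, G (t, q) ∂(S.discTrajectory n t) := by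
  -- The floor and `t` are treated as independent variables: one is countable, the dependence on the
  -- other is continuous.
  have h : Measurable fun p : ℕ × ℝ =>
      ∑ i ∈ basicIndices d n, ∫ q, G (p.2, q) ∂(S.cellPlan n p.1 i) :=
    measurable_from_prod_countable_right fun k => (continuous_finsetSum _ fun i _ =>
      continuous_integral_slice (S.cellPlan n k i) hG hM).measurable
  have h2 : Measurable fun t : ℝ => (⌊(n : ℝ) * t⌋₊, t) :=
    (Nat.measurable_floor.comp (measurable_const_mul _)).prodMk measurable_id
  convert h.comp h2 using 1
  ext t
  exact S.integral_discTrajectory hn t (hG.comp (Continuous.prodMk_right t)) fun q => hM (t, q)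

lemma norm_integral_discTrajectory_le (hn : n ∈ levels) (t : ℝ) {g : E d × E d → ℝ}
    {M : ℝ} (hM : ∀ q, ‖g q‖ ≤ M) : ‖∫ q, g q ∂(S.discTrajectory n t)‖ ≤ M := by
  have h : (S.discTrajectory n t).real univ = 1 := by
    rw [measureReal_def, ← Measure.fst_univ, S.discTrajectory_fst hn, measure_univ,
      ENNReal.toReal_one]
  simpa [h] using norm_integral_le_of_norm_le_const (μ := S.discTrajectory n t)
    (Eventually.of_forall hM)

lemma integral_integral_discTrajectory (hn : n ∈ levels) {G : ℝ × E d × E d → ℝ}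
    (hG : Continuous G) {M : ℝ} (hM : ∀ p, ‖G p‖ ≤ M) (T : ℕ) :
    ∫ t in Ico (0 : ℝ) T, ∫ q, G (t, q) ∂(S.discTrajectory n t)
      = ∑ k ∈ Finset.range (n * T), ∫ t in Ico ((k : ℝ) / n) (((k : ℝ) + 1) / n),
          ∑ i ∈ basicIndices d n, ∫ q, G (t, q) ∂(S.cellPlan n k i) := by
  have hn0 : (0 : ℝ) < n := by exact_mod_cast hn.2
  have hbd : ∀ t, ‖∫ q, G (t, q) ∂(S.discTrajectory n t)‖ ≤ M := fun t =>
    S.norm_integral_discTrajectory_le hn t fun q => hM (t, q)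
  have hint : ∀ a b : ℝ, IntervalIntegrable
      (fun t => ∫ q, G (t, q) ∂(S.discTrajectory n t)) volume a b := fun a b =>
    ⟨Integrable.of_bound (S.measurable_integral_discTrajectory hn hG hM).aestronglyMeasurable M
        (Eventually.of_forall hbd),
      Integrable.of_bound (S.measurable_integral_discTrajectory hn hG hM).aestronglyMeasurable M
        (Eventually.of_forall hbd)⟩
  have hsum := intervalIntegral.sum_integral_adjacent_intervals (a := fun k : ℕ => (k : ℝ) / n)
    (n := n * T) fun k _ => hint (k / n) ((k + 1 : ℕ) / n)
  have hTn : ((n * T : ℕ) : ℝ) / n = T := by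
    rw [Nat.cast_mul]
    field_simp
  simp only [Nat.cast_zero, zero_div, hTn] at hsum
  rw [integral_Ico_eq_integral_Ioc, ← intervalIntegral.integral_of_le (Nat.cast_nonneg T), ← hsum]
  refine Finset.sum_congr rfl fun k _ => ?_
  rw [Nat.cast_add_one, intervalIntegral.integral_of_le (by gcongr; linarith),
    ← integral_Ico_eq_integral_Ioc]
  refine setIntegral_congr_fun measurableSet_Ico fun t ht => ?_
  have hfl : ⌊(n : ℝ) * t⌋₊ = k := by
    have h1 := ht.1
    have h2 := ht.2
    rw [div_le_iff₀ hn0, mul_comm] at h1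
    rw [lt_div_iff₀ hn0, mul_comm] at h2
    exact (Nat.floor_eq_iff ((Nat.cast_nonneg k).trans h1)).2 ⟨h1, h2⟩
  rw [S.integral_discTrajectory hn t (g := fun q => G (t, q)) (by fun_prop) fun q => hM (t, q), hfl]

/-- One time step of the discrete continuity equation. -/
lemma abs_step_sub_le (hn : n ∈ levels) (k : ℕ) {δ : ℝ} {G₀ Gt : ℝ × E d × E d → ℝ}
    {Gx : Fin d → ℝ × E d × E d → ℝ} (hG₀ : Continuous G₀) (hGt : Continuous Gt)
    (hGx : ∀ l, Continuous (Gx l)) {M : ℝ} (hM₀ : ∀ p, ‖G₀ p‖ ≤ M) (hMt : ∀ p, ‖Gt p‖ ≤ M)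
    (hMx : ∀ l p, ‖Gx l p‖ ≤ M)
    (h : ∀ i ∈ basicIndices d n, ∀ t ∈ Ico ((k : ℝ) / n) (((k : ℝ) + 1) / n), ∀ x ∈ unitCube d,
      x ∈ cellSet n (compositeCell n (kindAt k) i) → ∀ y ∈ S.Y,
      |Gt (t, x, y) + ∑ l, direction n k i l * Gx l (t, x, y)
        - n * (G₀ (((k : ℝ) + 1) / n, cellCenter n (kindAt (k + 1)) i, y)
          - G₀ ((k : ℝ) / n, cellCenter n (kindAt k) i, y))| ≤ δ) :
    |(∫ t in Ico ((k : ℝ) / n) (((k : ℝ) + 1) / n), (∑ i ∈ basicIndices d n,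
        (∫ q, Gt (t, q) ∂(S.cellPlan n k i)
          + ∑ l, direction n k i l * ∫ q, Gx l (t, q) ∂(S.cellPlan n k i))))
      - (S.cellSum G₀ n (k + 1) - S.cellSum G₀ n k)| ≤ δ / n := by
  have hn0 : (0 : ℝ) < n := by exact_mod_cast hn.2
  set I := Ico ((k : ℝ) / n) (((k : ℝ) + 1) / n) with hI
  have hvol : volume.real I = 1 / n := by
    rw [hI, Real.volume_real_Ico_of_le (by gcongr; linarith), ← sub_div, add_sub_cancel_left]
  set V : ℝ → (Fin d → ℕ) → ℝ := fun t i => ∫ q, Gt (t, q) ∂(S.cellPlan n k i)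
    + ∑ l, direction n k i l * ∫ q, Gx l (t, q) ∂(S.cellPlan n k i) with hV
  set D : (Fin d → ℕ) → E d → ℝ := fun i y =>
    G₀ (((k : ℝ) + 1) / n, cellCenter n (kindAt (k + 1)) i, y)
      - G₀ ((k : ℝ) / n, cellCenter n (kindAt k) i, y) with hD
  have hDc : ∀ i, Continuous (D i) := fun i => by fun_prop
  have hDi : ∀ i, Integrable (fun q : E d × E d => D i q.2) (S.cellPlan n k i) := fun i =>
    integrable_of_continuous_of_bound _ ((hDc i).comp continuous_snd) (M := M + M)
      fun q => (norm_sub_le _ _).trans (add_le_add (hM₀ _) (hM₀ _))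
  have hdiff : S.cellSum G₀ n (k + 1) - S.cellSum G₀ n k
      = ∑ i ∈ basicIndices d n, ∫ q, D i q.2 ∂(S.cellPlan n k i) := by
    rw [S.cellSum_succ hn k hG₀ hM₀, cellSum, ← Finset.sum_sub_distrib]
    refine Finset.sum_congr rfl fun i hi => ?_
    rw [← S.integral_cellMarginal_eq_cellPlan hn k hi (hDc i), ← integral_sub]
    · exact integrable_of_continuous_of_bound _ (by fun_prop) fun y => hM₀ _
    · exact integrable_of_continuous_of_bound _ (by fun_prop) fun y => hM₀ _
  have hVint : IntegrableOn (fun t => ∑ i ∈ basicIndices d n, V t i) I := by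
    refine (Continuous.integrableOn_Icc ?_).mono_set Ico_subset_Icc_self
    exact continuous_finsetSum _ fun i _ => (continuous_integral_slice _ hGt hMt).add
      (continuous_finsetSum _ fun l _ =>
        continuous_const.mul (continuous_integral_slice _ (hGx l) (hMx l)))
  -- The slice has length `1 / n`, so the increment becomes the integral over the slice of `n` times
  -- itself and can be compared pointwise in `t`.
  have hconst : S.cellSum G₀ n (k + 1) - S.cellSum G₀ n k
      = ∫ _t in I, n * ∑ i ∈ basicIndices d n, ∫ q, D i q.2 ∂(S.cellPlan n k i) := by
    rw [setIntegral_const, hvol, hdiff, smul_eq_mul]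
    field_simp
  have hIfin : volume I < ∞ := measure_Ico_lt_top
  rw [hconst, ← integral_sub hVint (integrableOn_const hIfin.ne), ← Real.norm_eq_abs,
    div_eq_mul_one_div, ← hvol]
  refine norm_setIntegral_le_of_norm_le_const hIfin fun t ht => ?_
  -- The error of each cell is weighted by its mass. The masses sum to one, so the number of cells
  -- does not matter.
  have hterm : ∀ i ∈ basicIndices d n,
      ‖V t i - n * ∫ q, D i q.2 ∂(S.cellPlan n k i)‖ ≤ δ * (S.cellPlan n k i).real univ := by
    intro i hi
    have it : Integrable (fun q => Gt (t, q)) (S.cellPlan n k i) :=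
      integrable_of_continuous_of_bound _ (by fun_prop) fun q => hMt _
    have ix : ∀ l, Integrable (fun q => direction n k i l * Gx l (t, q)) (S.cellPlan n k i) :=
      fun l => (integrable_of_continuous_of_bound _ (by fun_prop) fun q => hMx l _).const_mul _
    have is : Integrable (fun q => ∑ l, direction n k i l * Gx l (t, q)) (S.cellPlan n k i) :=
      integrable_finsetSum _ fun l _ => ix l
    have its : Integrable (fun q => Gt (t, q) + ∑ l, direction n k i l * Gx l (t, q))
        (S.cellPlan n k i) := it.add is
    have heq : V t i - n * ∫ q, D i q.2 ∂(S.cellPlan n k i)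
        = ∫ q, (Gt (t, q) + ∑ l, direction n k i l * Gx l (t, q) - n * D i q.2)
          ∂(S.cellPlan n k i) := by
      rw [integral_sub its ((hDi i).const_mul _), integral_add it is, integral_finsetSum _ fun l _ => ix l]
      simp only [integral_const_mul, hV]
    rw [heq]
    refine norm_integral_le_of_norm_le_const ?_
    filter_upwards [S.ae_cellPlan hn k hi] with q hq
    exact h i hi t ht q.1 hq.2.1 hq.1 q.2 hq.2.2
  rw [Finset.mul_sum, ← Finset.sum_sub_distrib]
  calc _ ≤ ∑ i ∈ basicIndices d n, δ * (S.cellPlan n k i).real univ :=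
        (norm_sum_le _ _).trans (Finset.sum_le_sum hterm)
    _ = δ := by rw [← Finset.mul_sum, S.sum_cellPlan_real_univ hn k, mul_one]

/-- Along the levels, the initial value of the telescoping quantity approaches the integral against
the initial plan. -/
lemma eventually_abs_cellSum_zero_sub_le {G : ℝ × E d × E d → ℝ} (hG : Continuous G)
    (hc : HasCompactSupport G) {δ : ℝ} (hδ : 0 < δ) :
    ∀ᶠ n in along levels,
      |S.cellSum G n 0 - ∫ q, G (0, q) ∂(S.πinitn n : Measure (E d × E d))| ≤ δ := by
  obtain ⟨M, hM⟩ := hc.exists_bound_of_continuous hG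
  obtain ⟨C, hC, hGC⟩ := exists_dist_le_add_mul_dist hG hc (half_pos hδ)
  filter_upwards [eventually_mem_along levels,
    eventually_const_div_lt_along levels (C * d) (half_pos hδ)] with n hn hnδ
  set P := (S.iter n 0 : Measure (E d × E d)) with hP
  have hP0 : (S.πinitn n : Measure (E d × E d)) = P := ((S.iter_run n hn).zero).symm
  have hsum := sum_restrict_basicCell_prod hn.2 (S.nullOverlaps_iter hn 0)
    (S.iter_fst_compl_unitCube hn 0)
  rw [hP0]
  have hi1 : ∀ i, Integrable (fun q : E d × E d => G (0, q)) (P.restrict (basicCell n i ×ˢ univ)) :=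
    fun i => integrable_of_continuous_of_bound _ (by fun_prop) fun q => hM _
  have hi2 : ∀ i, Integrable (fun q : E d × E d => G (0, cellCenter n (kindAt 0) i, q.2))
      (P.restrict (basicCell n i ×ˢ univ)) :=
    fun i => integrable_of_continuous_of_bound _ (by fun_prop) fun q => hM _
  have h1 : ∫ q, G (0, q) ∂P
      = ∑ i ∈ basicIndices d n, ∫ q, G (0, q) ∂(P.restrict (basicCell n i ×ˢ univ)) := by
    rw [← integral_finsetSum_measure fun i _ => hi1 i, hsum]
  have h2 : S.cellSum G n 0 = ∑ i ∈ basicIndices d n,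
      ∫ q, G (0, cellCenter n (kindAt 0) i, q.2) ∂(P.restrict (basicCell n i ×ˢ univ)) := by
    refine Finset.sum_congr rfl fun i _ => ?_
    rw [cellMarginal, cellSet_singleton, partialMarginal, Measure.snd, integral_map
      measurable_snd.aemeasurable (Continuous.aestronglyMeasurable (by fun_prop))]
    simp [hP]
  rw [h1, h2, ← Finset.sum_sub_distrib]
  have hterm : ∀ i ∈ basicIndices d n,
      ‖∫ q, G (0, cellCenter n (kindAt 0) i, q.2) ∂(P.restrict (basicCell n i ×ˢ univ))
        - ∫ q, G (0, q) ∂(P.restrict (basicCell n i ×ˢ univ))‖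
      ≤ δ * (P.restrict (basicCell n i ×ˢ univ)).real univ := by
    intro i _
    rw [← integral_sub (hi2 i) (hi1 i)]
    refine norm_integral_le_of_norm_le_const ?_
    filter_upwards [ae_restrict_mem ((measurableSet_basicCell i).prod .univ)] with q hq
    have hdist : dist (cellCenter n (kindAt 0) i) q.1 ≤ d / n :=
      dist_le_of_mem_basicCell (cellCenter_mem_basicCell _ i) hq.1
    have hle := hGC (0, cellCenter n (kindAt 0) i, q.2) (0, q)
    have hdist' : dist ((0 : ℝ), cellCenter n (kindAt 0) i, q.2) (0, q) ≤ d / n := by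
      simpa [Prod.dist_eq] using hdist
    have h3 := mul_le_mul_of_nonneg_left hdist' hC.le
    rw [← mul_div_assoc] at h3
    rw [Real.norm_eq_abs]
    linarith
  have hmass : ∑ i ∈ basicIndices d n, (P.restrict (basicCell n i ×ˢ univ)).real univ = 1 := by
    have h4 := congrArg (fun m => (m univ).toReal) hsum
    simp only [Measure.finsetSum_apply] at h4
    rw [ENNReal.toReal_sum fun _ _ => measure_ne_top _ _] at h4
    simpa [measureReal_def] using h4
  calc _ ≤ ∑ i ∈ basicIndices d n, δ * (P.restrict (basicCell n i ×ˢ univ)).real univ :=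
        (Finset.abs_sum_le_sum_abs _ _).trans (Finset.sum_le_sum hterm)
    _ = δ := by rw [← Finset.mul_sum, hmass, mul_one]

lemma cellSum_eq_zero (hn : n ∈ levels) {G : ℝ × E d × E d → ℝ} {T : ℕ}
    (hT : ∀ p ∈ spaceTime S.Y, (T : ℝ) ≤ p.1 → G p = 0) : S.cellSum G n (n * T) = 0 := by
  have hn0 : (n : ℝ) ≠ 0 := by exact_mod_cast hn.2.ne'
  have hTn : ((n * T : ℕ) : ℝ) / n = T := by
    rw [Nat.cast_mul]
    field_simp
  refine Finset.sum_eq_zero fun i hi => integral_eq_zero_of_ae ?_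
  filter_upwards [S.ae_cellMarginal hn (n * T) {i}] with y hy
  rw [hTn]
  exact hT _ ⟨mem_Ici.2 (Nat.cast_nonneg T), basicCell_subset_unitCube hi (cellCenter_mem_basicCell _ i), hy⟩
    le_rfl

/-- The discrete trajectories and momenta solve the horizontal continuity equation up to an error
that vanishes along the levels. -/
lemma tendsto_discrete_continuity_equation {φ : ℝ × E d × E d → ℝ} (hφ : IsTestFunction S.Y φ)
    {T : ℕ} {G₀ Gt : ℝ × E d × E d → ℝ} {Gx : Fin d → ℝ × E d × E d → ℝ}
    (hG₀ : Continuous G₀) (hGt : Continuous Gt) (hGx : ∀ l, Continuous (Gx l))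
    (hc₀ : HasCompactSupport G₀) (hct : HasCompactSupport Gt)
    (hcx : ∀ l, HasCompactSupport (Gx l)) (he₀ : EqOn G₀ φ (spaceTime S.Y))
    (het : EqOn Gt (timeDeriv φ) (spaceTime S.Y))
    (hex : ∀ l, EqOn (Gx l) (spaceDeriv φ l) (spaceTime S.Y))
    (hT₀ : ∀ p ∈ spaceTime S.Y, (T : ℝ) ≤ p.1 → G₀ p = 0)
    (hTx : ∀ l, ∀ p ∈ spaceTime S.Y, (T : ℝ) ≤ p.1 → Gx l p = 0) :
    Tendsto (fun n => (∫ t in Ico (0 : ℝ) T, ∫ q, Gt (t, q) ∂(S.discTrajectory n t))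
      + ∑ l, ((S.discMomentum n l).upTo T).integral (Gx l)
      + ∫ q, G₀ (0, q) ∂(S.πinitn n : Measure (E d × E d))) (along levels) (𝓝 0) := by
  obtain ⟨M₀, hM₀⟩ := hc₀.exists_bound_of_continuous hG₀
  obtain ⟨Mt, hMt⟩ := hct.exists_bound_of_continuous hGt
  choose Mx hMx using fun l => (hcx l).exists_bound_of_continuous (hGx l)
  obtain ⟨M, hM⟩ : ∃ M, M₀ ≤ M ∧ Mt ≤ M ∧ ∀ l, Mx l ≤ M := by
    refine ⟨|M₀| + |Mt| + ∑ l, |Mx l|, ?_, ?_, fun l => ?_⟩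
    · have := Finset.sum_nonneg fun l (_ : l ∈ Finset.univ) => abs_nonneg (Mx l)
      linarith [le_abs_self M₀, abs_nonneg Mt]
    · have := Finset.sum_nonneg fun l (_ : l ∈ Finset.univ) => abs_nonneg (Mx l)
      linarith [le_abs_self Mt, abs_nonneg M₀]
    · have := Finset.single_le_sum (fun l _ => abs_nonneg (Mx l)) (Finset.mem_univ l)
      linarith [le_abs_self (Mx l), abs_nonneg M₀, abs_nonneg Mt]
  rw [Metric.tendsto_nhds]
  intro ε hε
  -- The `n * T` steps cost `δ / n` each, thus `T * δ`; the initial term costs `δ`, and one more `δ`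
  -- makes the inequality strict.
  set δ : ℝ := ε / (T + 2) with hδdef
  have hδ : 0 < δ := by positivity
  filter_upwards [eventually_mem_along levels, hφ.eventually_abs_sub_le S.isCompact_Y T hδ,
    S.eventually_abs_cellSum_zero_sub_le hG₀ hc₀ hδ] with n hn hstep hinit
  have hn0 : (0 : ℝ) < n := by exact_mod_cast hn.2
  set V : ℕ → ℝ → ℝ := fun k t => ∑ i ∈ basicIndices d n,
    (∫ q, Gt (t, q) ∂(S.cellPlan n k i)
      + ∑ l, direction n k i l * ∫ q, Gx l (t, q) ∂(S.cellPlan n k i)) with hV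
  have hsum : (∫ t in Ico (0 : ℝ) T, ∫ q, Gt (t, q) ∂(S.discTrajectory n t))
      + ∑ l, ((S.discMomentum n l).upTo T).integral (Gx l)
      = ∑ k ∈ Finset.range (n * T), ∫ t in Ico ((k : ℝ) / n) (((k : ℝ) + 1) / n), V k t := by
    rw [S.integral_integral_discTrajectory hn hGt hMt,
      Finset.sum_congr rfl fun l _ => S.discMomentum_integral hn l (hGx l) (hMx l) (hTx l),
      Finset.sum_comm, ← Finset.sum_add_distrib]
    refine Finset.sum_congr rfl fun k _ => ?_
    have hint : ∀ {g : ℝ → ℝ}, Continuous g →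
        IntegrableOn g (Ico ((k : ℝ) / n) (((k : ℝ) + 1) / n)) := fun hg =>
      hg.integrableOn_Icc.mono_set Ico_subset_Icc_self
    have hct' : Continuous fun t => ∑ i ∈ basicIndices d n,
        ∫ q, Gt (t, q) ∂(S.cellPlan n k i) :=
      continuous_finsetSum _ fun i _ => continuous_integral_slice _ hGt hMt
    have hcx' : ∀ l, Continuous fun t => ∑ i ∈ basicIndices d n,
        direction n k i l * ∫ q, Gx l (t, q) ∂(S.cellPlan n k i) := fun l =>
      continuous_finsetSum _ fun i _ =>
        continuous_const.mul (continuous_integral_slice _ (hGx l) (hMx l))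
    rw [← integral_finsetSum _ fun l _ => hint (hcx' l), ← integral_add (hint hct')
      (hint (continuous_finsetSum _ fun l _ => hcx' l))]
    refine integral_congr_ae (Eventually.of_forall fun t => ?_)
    simp only [hV, Finset.sum_add_distrib]
    rw [Finset.sum_comm]
  have hk : ∀ k ∈ Finset.range (n * T),
      |(∫ t in Ico ((k : ℝ) / n) (((k : ℝ) + 1) / n), V k t)
        - (S.cellSum G₀ n (k + 1) - S.cellSum G₀ n k)| ≤ δ / n := by
    intro k hk
    refine S.abs_step_sub_le hn k hG₀ hGt hGx (fun p => (hM₀ p).trans hM.1)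
      (fun p => (hMt p).trans hM.2.1) (fun l p => (hMx l p).trans (hM.2.2 l)) ?_
    intro i hi t ht x hx hxJ y hy
    have ht0 : 0 ≤ t := le_trans (by positivity) ht.1
    have hc : ∀ τ : Kind, cellCenter n τ i ∈ unitCube d := fun τ =>
      basicCell_subset_unitCube hi (cellCenter_mem_basicCell τ i)
    have key := hstep k (Finset.mem_range.1 hk) i hi t ht x hx hxJ y hy
    have hmem : (t, x, y) ∈ spaceTime S.Y := ⟨ht0, hx, hy⟩
    rw [het hmem, he₀ ⟨mem_Ici.2 (by positivity), hc _, hy⟩,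
      he₀ ⟨mem_Ici.2 (by positivity), hc _, hy⟩, Finset.sum_congr rfl fun l _ => by
        rw [hex l hmem]]
    exact key
  have htel : ∑ k ∈ Finset.range (n * T), (S.cellSum G₀ n (k + 1) - S.cellSum G₀ n k)
      = - S.cellSum G₀ n 0 := by
    rw [Finset.sum_range_sub, S.cellSum_eq_zero hn hT₀, zero_sub]
  have hbound : |∑ k ∈ Finset.range (n * T),
      ((∫ t in Ico ((k : ℝ) / n) (((k : ℝ) + 1) / n), V k t)
        - (S.cellSum G₀ n (k + 1) - S.cellSum G₀ n k))| ≤ T * δ := by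
    calc _ ≤ ∑ _k ∈ Finset.range (n * T), δ / n :=
          (Finset.abs_sum_le_sum_abs _ _).trans (Finset.sum_le_sum hk)
      _ = T * δ := by
          rw [Finset.sum_const, Finset.card_range, nsmul_eq_mul, Nat.cast_mul]
          field_simp
  rw [Finset.sum_sub_distrib, htel, ← hsum] at hbound
  rw [Real.dist_eq, sub_zero]
  have hεδ : ε = (T + 2) * δ := by
    rw [hδdef]
    field_simp
  rw [abs_le] at hbound hinit
  rw [abs_lt]
  constructor <;> nlinarith [hbound.1, hbound.2, hinit.1, hinit.2]

/-! ### Passage to the limit -/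

/-- Convergence of the time-integrated trajectories. -/
lemma TrajectoryConverges.tendsto_integral {S : Setting d} {Z : Set ℕ}
    {π : Kernel ℝ (E d × E d)} [IsFiniteKernel π] (hπ : S.TrajectoryConverges Z π)
    {G : ℝ × E d × E d → ℝ} (hG : Continuous G) (hc : HasCompactSupport G) (T : ℝ) :
    Tendsto (fun n => ∫ t in Ico (0 : ℝ) T, ∫ q, G (t, q) ∂(S.discTrajectory n t)) (along Z)
      (𝓝 (∫ t in Ico (0 : ℝ) T, ∫ q, G (t, q) ∂(π t))) := by
  obtain ⟨M, hM⟩ := hc.exists_bound_of_continuous hG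
  have hlev : ∀ᶠ n in along Z, n ∈ levels := (eventually_mem_along Z).mono fun n hn => hπ.subset hn
  have : (along Z).IsCountablyGenerated := by
    unfold along
    infer_instance
  refine tendsto_integral_filter_of_dominated_convergence (fun _ => M) ?_ ?_
    (integrableOn_const measure_Ico_lt_top.ne) ?_
  · filter_upwards [hlev] with n hn
    exact (S.measurable_integral_discTrajectory hn hG hM).aestronglyMeasurable
  · filter_upwards [hlev] with n hn
    exact Eventually.of_forall fun t => S.norm_integral_discTrajectory_le hn t fun q => hM (t, q)
  · filter_upwards [ae_restrict_of_ae_restrict_of_subset Ico_subset_Ici_self hπ.coupling,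
      ae_restrict_of_ae_restrict_of_subset Ico_subset_Ici_self hπ.tendsto] with t ht1 ht2
    refine tendsto_integral_of_verticalDist (hlev.mono fun n hn => S.discTrajectory_fst hn t) ht1.1
      ht2 (g := fun q => G (t, q)) (by fun_prop) (fun q => hM (t, q)) fun δ hδ => ?_
    obtain ⟨C, hC, hGC⟩ := exists_dist_le_add_mul_dist hG hc hδ
    exact ⟨C, hC, fun p q => by simpa [Prod.dist_eq] using hGC (t, p) (t, q)⟩

/-- The integral against the limit trajectory is an iterated integral over a bounded time
interval. -/
lemma TrajectoryConverges.integral_compProd_eq {S : Setting d} {Z : Set ℕ}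
    {π : Kernel ℝ (E d × E d)} [IsFiniteKernel π] (hπ : S.TrajectoryConverges Z π)
    {g G : ℝ × E d × E d → ℝ} (hG : Continuous G) (hc : HasCompactSupport G)
    (hgG : EqOn G g (spaceTime S.Y)) {T : ℝ} (hT0 : 0 ≤ T)
    (hT : ∀ p ∈ spaceTime S.Y, T ≤ p.1 → G p = 0) :
    ∫ p, g p ∂((volume.restrict (Ici (0 : ℝ))).compProd π)
      = ∫ t in Ico (0 : ℝ) T, ∫ q, G (t, q) ∂(π t) := by
  obtain ⟨M, hM⟩ := hc.exists_bound_of_continuous hG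
  have hmeas : MeasurableSet (spaceTime S.Y) := measurableSet_Ici.prod
    ((isClosed_unitCube d).measurableSet.prod S.isCompact_Y.measurableSet)
  have hae : ∀ᵐ p ∂((volume.restrict (Ici (0 : ℝ))).compProd π), p ∈ spaceTime S.Y := by
    refine Measure.ae_compProd_of_ae_ae hmeas ?_
    filter_upwards [hπ.coupling, ae_restrict_mem measurableSet_Ici] with t ht ht0
    have h1 : ∀ᵐ x ∂(π t).fst, x ∈ unitCube d := by
      rw [ht.1]
      exact S.μ_supp
    have h2 : ∀ᵐ y ∂(π t).snd, y ∈ S.Y := by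
      rw [ht.2]
      exact S.ν_supp
    filter_upwards [ae_of_ae_map measurable_fst.aemeasurable h1,
      ae_of_ae_map measurable_snd.aemeasurable h2] with q hq1 hq2
    exact ⟨ht0, hq1, hq2⟩
  -- Boundedness of `G` gives integrability only on bounded time intervals. On the rest `G` vanishes
  -- almost everywhere.
  have hsplit : (volume.restrict (Ici (0 : ℝ))) ⊗ₘ π
      = (volume.restrict (Ico 0 T)) ⊗ₘ π + (volume.restrict (Ici T)) ⊗ₘ π := by
    rw [← Measure.compProd_add_left, ← Measure.restrict_union ?_ measurableSet_Ici,
      Ico_union_Ici_eq_Ici hT0]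
    exact disjoint_left.2 fun t h1 h2 => absurd h1.2 (not_lt.2 h2)
  have htail : G =ᵐ[(volume.restrict (Ici T)) ⊗ₘ π] 0 := by
    have h1 : ∀ᵐ p ∂((volume.restrict (Ici T)) ⊗ₘ π), p ∈ spaceTime S.Y := by
      rw [hsplit] at hae
      exact ae_mono (Measure.le_add_left le_rfl) hae
    have h2 : ∀ᵐ p ∂((volume.restrict (Ici T)) ⊗ₘ π), T ≤ p.1 :=
      Measure.ae_compProd_of_ae_fst π measurableSet_Ici (ae_restrict_mem measurableSet_Ici)
    filter_upwards [h1, h2] with p hp1 hp2 using hT p hp1 hp2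
  have hint : Integrable G ((volume.restrict (Ico 0 T)) ⊗ₘ π) :=
    integrable_of_continuous_of_bound _ hG hM
  have hcongr : g =ᵐ[(volume.restrict (Ici (0 : ℝ))) ⊗ₘ π] G :=
    hae.mono fun p hp => (hgG hp).symm
  rw [integral_congr_ae hcongr, hsplit, integral_add_measure hint
    ((integrable_congr htail).2 (integrable_zero _ _ _)), integral_congr_ae htail,
    Measure.integral_compProd hint]
  simp

end Setting

lemma SignedPair.IsRadonOn.integral_eq_upTo {Y : Set (E d)} {m : SignedPair d}
    (hm : m.IsRadonOn Y) {g G : ℝ × E d × E d → ℝ} (hgG : EqOn G g (spaceTime Y)) {T : ℝ}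
    (hT : ∀ p ∈ spaceTime Y, T ≤ p.1 → G p = 0) :
    m.integral g = (m.upTo T).integral G := by
  have key : ∀ μ : Measure (ℝ × E d × E d), μ (Ici (0 : ℝ) ×ˢ unitCube d ×ˢ Y)ᶜ = 0 →
      ∫ p, g p ∂μ = ∫ p, G p ∂(μ.restrict (Icc 0 T ×ˢ univ)) := fun μ hμ => by
    have hae : ∀ᵐ p ∂μ, p ∈ spaceTime Y := hμ
    rw [setIntegral_eq_integral_of_ae_compl_eq_zero]
    · exact integral_congr_ae (hae.mono fun p hp => (hgG hp).symm)
    · refine hae.mono fun p hp hpT => hT p hp ?_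
      by_contra hlt
      exact hpT ⟨⟨hp.1, (not_le.1 hlt).le⟩, mem_univ _⟩
  rw [SignedPair.integral, SignedPair.integral, key _ hm.pos_supp, key _ hm.neg_supp]
  rfl

lemma along_neBot {Z : Set ℕ} (hZ : Z.Infinite) : (along Z).NeBot :=
  frequently_mem_iff_neBot.1 (Nat.frequently_atTop_iff_infinite.2 hZ)

lemma along_mono {Z Z' : Set ℕ} (h : Z ⊆ Z') : along Z ≤ along Z' :=
  inf_le_inf_left _ (principal_mono.2 h)

end DomDec

theorem mainTheorem6 {d : ℕ} (S : DomDec.Setting d)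
    (Z : Set ℕ) (π : ProbabilityTheory.Kernel ℝ (DomDec.E d × DomDec.E d))
    [ProbabilityTheory.IsFiniteKernel π] (hπ : S.TrajectoryConverges Z π)
    (Z' : Set ℕ) (hZ' : Z' ⊆ Z) (hZ'inf : Z'.Infinite)
    (ω : Fin d → DomDec.SignedPair d) (hωR : ∀ l, (ω l).IsRadonOn S.Y)
    (hω : S.MomentumConverges Z' ω) :
    DomDec.SolvesHorizontalCE S.Y
      ((MeasureTheory.volume.restrict (Set.Ici (0 : ℝ))).compProd π) ω
      (S.πinit : MeasureTheory.Measure (DomDec.E d × DomDec.E d)) := by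
  intro φ hφ
  obtain ⟨T, hT0, hT⟩ := hφ.exists_time_bound
  have hTt : ∀ p ∈ DomDec.spaceTime S.Y, (T : ℝ) ≤ p.1 → DomDec.timeDeriv φ p = 0 :=
    fun p hp hpT => by rw [DomDec.timeDeriv, (hT p hp hpT).2]; rfl
  have hTx : ∀ l, ∀ p ∈ DomDec.spaceTime S.Y, (T : ℝ) ≤ p.1 → DomDec.spaceDeriv φ l p = 0 :=
    fun l p hp hpT => by rw [DomDec.spaceDeriv, (hT p hp hpT).2]; rfl
  obtain ⟨G₀, hG₀, hc₀, he₀⟩ := DomDec.exists_hasCompactSupport_extension S.isCompact_Y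
    hφ.contDiffOn.continuousOn fun p hp hpT => (hT p hp hpT).1
  obtain ⟨Gt, hGt, hct, het⟩ := DomDec.exists_hasCompactSupport_extension S.isCompact_Y
    hφ.continuousOn_timeDeriv hTt
  choose Gx hGx hcx hex using fun l => DomDec.exists_hasCompactSupport_extension S.isCompact_Y
    (hφ.continuousOn_spaceDeriv l) (hTx l)
  have hTGx : ∀ l, ∀ p ∈ DomDec.spaceTime S.Y, (T : ℝ) ≤ p.1 → Gx l p = 0 :=
    fun l p hp hpT => (hex l hp).trans (hTx l p hp hpT)
  have hle : DomDec.along Z' ≤ DomDec.along DomDec.levels :=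
    DomDec.along_mono (hZ'.trans hπ.subset)
  have hne : (DomDec.along Z').NeBot := DomDec.along_neBot hZ'inf
  have hzero := (S.tendsto_discrete_continuity_equation hφ hG₀ hGt hGx hc₀ hct hcx he₀ het hex
    (fun p hp hpT => (he₀ hp).trans (hT p hp hpT).1) hTGx).mono_left hle
  have htraj := (hπ.tendsto_integral hGt hct T).mono_left (DomDec.along_mono hZ')
  have hmom : Tendsto (fun n => ∑ l, ((S.discMomentum n l).upTo T).integral (Gx l))
      (DomDec.along Z') (𝓝 (∑ l, ((ω l).upTo T).integral (Gx l))) :=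
    tendsto_finsetSum _ fun l _ => hω T (by exact_mod_cast hT0) l (Gx l) (hGx l)
  obtain ⟨M₀, hM₀⟩ := hc₀.exists_bound_of_continuous hG₀
  have hinit : Tendsto (fun n => ∫ q, G₀ (0, q) ∂(S.πinitn n : Measure (DomDec.E d × DomDec.E d)))
      (DomDec.along Z') (𝓝 (∫ q, G₀ (0, q) ∂(S.πinit : Measure (DomDec.E d × DomDec.E d)))) :=
    ProbabilityMeasure.tendsto_iff_forall_integral_tendsto.1 (S.πinitn_tendsto.mono_left hle)
      (BoundedContinuousFunction.ofNormedAddCommGroup (fun q => G₀ (0, q)) (by fun_prop) M₀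
        fun q => hM₀ (0, q))
  -- The discrete equation, evaluated along `Z'`, has both the sum of the three limits and zero as
  -- its limit.
  have hlim := tendsto_nhds_unique ((htraj.add hmom).add hinit) hzero
  have hφ0 : ∫ q, φ (0, q.1, q.2) ∂(S.πinit : Measure (DomDec.E d × DomDec.E d))
      = ∫ q, G₀ (0, q) ∂(S.πinit : Measure (DomDec.E d × DomDec.E d)) := by
    have h1 : ∀ᵐ x ∂(S.πinit : Measure (DomDec.E d × DomDec.E d)).fst, x ∈ DomDec.unitCube d := by
      rw [S.πinit_coupling.1]
      exact S.μ_supp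
    have h2 : ∀ᵐ y ∂(S.πinit : Measure (DomDec.E d × DomDec.E d)).snd, y ∈ S.Y := by
      rw [S.πinit_coupling.2]
      exact S.ν_supp
    refine integral_congr_ae ?_
    filter_upwards [ae_of_ae_map measurable_fst.aemeasurable h1,
      ae_of_ae_map measurable_snd.aemeasurable h2] with q hq1 hq2
    exact (he₀ ⟨mem_Ici.2 le_rfl, hq1, hq2⟩).symm
  rw [hπ.integral_compProd_eq hGt hct het (Nat.cast_nonneg T)
      (fun p hp hpT => (het hp).trans (hTt p hp hpT)), hφ0,
    Finset.sum_congr rfl fun l _ => (hωR l).integral_eq_upTo (hex l) (hTGx l)]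
  linarith
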